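/- Let $(\hat\Omega,\mathcal A,\mu)$ be a $\sigma$-finite measure space, let $\Omega\subseteq\hat\Omega$ be measurable, and let $\Phi:\hat\Omega\times\hat\Omega\times\mathbb R\to[0,\infty]$ be such that $\Phi(\cdot,\cdot,s)$ is measurable on $\hat\Omega\times\hat\Omega$ for every $s\in\mathbb R$ and, for all $x,y\in\hat\Omega$, $\Phi(x,y,0)=0$, the function $\Phi(x,y,\cdot)$ is lower semicontinuous, convex and even, and $\Phi(x,y,\cdot)=\Phi(y,x,\cdot)$. A function $\Psi:\hat\Omega\times\hat\Omega\times\mathbb R\to[0,\infty]$ satisfies the $\Delta_2$-condition if there are a constant $K>0$ and a $\mu\otimes\mu$-integrable function $h:\hat\Omega\times\hat\Omega\to[0,\infty)$ such that $\Psi(x,y,2s)\le K\,\Psi(x,y,s)+h(x,y)$ for all $(x,y,s)\in\hat\Omega\times\hat\Omega\times\mathbb R$. The Fenchel conjugate of $\Phi$ is $\Phi^*(x,y,t)=\sup_{s\in\mathbb R}\,(st-\Phi(x,y,s))$. Let $\mathbf S_\Phi=\{(x,y)\in\hat\Omega\times\hat\Omega:\ \Phi(x,y,s)\neq0\text{ for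 some }s\in\mathbb R\}$. The set $\mathbf S_\Phi$ satisfies the thickness condition if there exist measurable sets $A^{(j)}_n\subseteq\hat\Omega$ and $B^{(j+1)}_n\subseteq\hat\Omega$ ($j,n\in\mathbb N=\{0,1,2,\dots\}$) and a set $\hat N\subseteq\hat\Omega$ of measure zero such that, with $I^{(j)}=\{n\in\mathbb N:\ \mu(A^{(j)}_n)>0\}$, - $A^{(0)}_n\subseteq\Omega$ for every $n\in\mathbb N$; - $A^{(j)}_n\times B^{(j+1)}_n\subseteq\mathbf S_\Phi$ for all $j,n\in\mathbb N$; - $\bigcup_{n\in\mathbb N}A^{(j+1)}_n=\bigcup_{n\in I^{(j)}}B^{(j+1)}_n$ for every $j\in\mathbb N$; - $\hat\Omega\setminus\hat N=\bigcup_{j\in\mathbb N}\bigcup_{n\in I^{(j)}}A^{(j)}_n$. Let $L^0(\hat\Omega)$ be the space of real measurable functions on $\hat\Omega$ modulo equality almost everywhere, and let $W^{\Phi,2}(\hat\Omega,\Omega)$ be the space of all $\hat u\in L^0(\hat\Omega)$ such that $\hat u|_\Omega\in L^2(\Omega)$ and $$\int_{\hat\Omega}\int_{\hat\Omega}\Phi\Big(x,y,\frac{\hat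 u(x)-\hat u(y)}{\lambda}\Big)\,d\mu(y)\,d\mu(x)<\infty\quad\text{for some }\lambda>0,$$ equipped with $$\|\hat u\|=\|\hat u|_\Omega\|_{L^2(\Omega)}+\inf\Big\{\lambda>0:\ \int_{\hat\Omega}\int_{\hat\Omega}\Phi\Big(x,y,\frac{\hat u(x)-\hat u(y)}{\lambda}\Big)\,d\mu(y)\,d\mu(x)\le1\Big\}.$$ **Lemma.** Suppose that $\Phi$ satisfies the $\Delta_2$-condition and that $\mathbf S_\Phi$ satisfies the thickness condition. Then $\|\cdot\|$ is a norm and $W^{\Phi,2}(\hat\Omega,\Omega)$ is a Banach space. Moreover, every sequence which converges in $W^{\Phi,2}(\hat\Omega,\Omega)$ has a subsequence which converges to its limit almost everywhere in $\hat\Omega$. If, in addition, $\Phi^*$ satisfies the $\Delta_2$-condition, then $W^{\Phi,2}(\hat\Omega,\Omega)$ is reflexive. -/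

import Mathlib

open MeasureTheory Filter Topology
open scoped NNReal ENNReal

namespace MusielakOrlicz

variable {X : Type*} [MeasurableSpace X]

/-- The measurability and convexity condition on `Φ : X × X × ℝ → [0, ∞]` (in curried form). -/
structure KernelCondition (Φ : X → X → ℝ → ℝ≥0∞) : Prop where
  measurable : ∀ s : ℝ, Measurable fun p : X × X => Φ p.1 p.2 s
  zero : ∀ x y, Φ x y 0 = 0
  lsc : ∀ x y, LowerSemicontinuous (Φ x y)
  convex : ∀ x y, ConvexOn ℝ≥0 Set.univ (Φ x y)
  even : ∀ x y s, Φ x y (-s) = Φ x y s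
  symm : ∀ x y, Φ x y = Φ y x

/-- The `Δ₂`-condition: `Φ (x, y, 2 s) ≤ K Φ (x, y, s) + h (x, y)` with `K > 0` and `h ≥ 0`
integrable with respect to the product measure. -/
def DeltaTwo (μ : Measure X) (Φ : X → X → ℝ → ℝ≥0∞) : Prop :=
  ∃ (K : ℝ) (h : X → X → ℝ), 0 < K ∧ (∀ x y, 0 ≤ h x y) ∧
    Integrable (fun p : X × X => h p.1 p.2) (μ.prod μ) ∧
    ∀ x y s, Φ x y (2 * s) ≤ ENNReal.ofReal K * Φ x y s + ENNReal.ofReal (h x y)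

/-- The Fenchel conjugate `Φ* (x, y, t) = sup_s (s t - Φ (x, y, s))`. The truncated operations
of `[0, ∞]` do no harm when `Φ (x, y, 0) = 0`, since the supremum is then nonnegative: see
`coe_fenchelConj`. -/
noncomputable def fenchelConj (Φ : X → X → ℝ → ℝ≥0∞) (x y : X) (t : ℝ) : ℝ≥0∞ :=
  ⨆ s : ℝ, (ENNReal.ofReal (s * t) - Φ x y s)

theorem coe_fenchelConj {Y : Type*} (Φ : Y → Y → ℝ → ℝ≥0∞) (x y : Y) (h0 : Φ x y 0 = 0) (t : ℝ) :
    (fenchelConj Φ x y t : EReal) = ⨆ s : ℝ, (((s * t : ℝ) : EReal) - (Φ x y s : EReal)) := by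
  have h1 : (0 : EReal) ≤ ⨆ s : ℝ, (((s * t : ℝ) : EReal) - (Φ x y s : EReal)) := by
    refine le_trans ?_ (le_iSup _ 0)
    simp [h0]
  apply le_antisymm
  · rw [← EReal.coe_toENNReal h1, EReal.coe_ennreal_le_coe_ennreal_iff]
    refine iSup_le fun s => ?_
    rw [tsub_le_iff_right]
    rcases eq_or_ne (Φ x y s) ⊤ with hs | hs
    · simp [hs]
    · rw [← EReal.coe_ennreal_le_coe_ennreal_iff, EReal.coe_ennreal_add, EReal.coe_toENNReal h1,
        EReal.coe_ennreal_ofReal]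
      rcases le_total (s * t) 0 with hst | hst
      · rw [max_eq_right hst]
        exact add_nonneg h1 (EReal.coe_ennreal_nonneg _)
      · rw [max_eq_left hst]
        have hb : (Φ x y s : EReal) ≠ ⊥ := EReal.coe_ennreal_ne_bot _
        have ht : (Φ x y s : EReal) ≠ ⊤ := by simpa using hs
        exact (EReal.sub_le_iff_le_add (.inl hb) (.inl ht)).1
          (le_iSup (fun s : ℝ => (((s * t : ℝ) : EReal) - (Φ x y s : EReal))) s)
  · refine iSup_le fun s => EReal.sub_le_of_le_add ?_
    have h2 : ENNReal.ofReal (s * t) ≤ fenchelConj Φ x y t + Φ x y s :=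
      tsub_le_iff_right.1 (le_iSup (fun s : ℝ => ENNReal.ofReal (s * t) - Φ x y s) s)
    rw [← EReal.coe_ennreal_le_coe_ennreal_iff, EReal.coe_ennreal_add,
      EReal.coe_ennreal_ofReal] at h2
    exact le_trans (EReal.coe_le_coe_iff.2 (le_max_left _ _)) h2

/-- The set `S_Φ`: the complement of `N_Φ = {(x, y) : Φ (x, y, s) = 0 for every s}`. -/
def activeSet (Φ : X → X → ℝ → ℝ≥0∞) : Set (X × X) :=
  {p | ∀ s : ℝ, Φ p.1 p.2 s = 0}ᶜ

/-- The set of indices `n` for which `A n` has positive measure. -/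
def posIndices (μ : Measure X) (A : ℕ → Set X) : Set ℕ :=
  {n | 0 < μ (A n)}

/-- The thickness condition on a set `S ⊆ X × X`, relative to `Ω ⊆ X`: starting from measurable
subsets `A 0 n` of `Ω`, one can choose recursively measurable sets `B (j + 1) n` with
`A j n × B (j + 1) n ⊆ S` and measurable sets `A (j + 1) n` which have the same union as those
`B (j + 1) n` for which `A j n` has positive measure, in such a way that the sets `A j n` of
positive measure cover `X` up to a null set. The sets `B 0 n` play no role. -/
def Thick (μ : Measure X) (Ω : Set X) (S : Set (X × X)) : Prop :=
  ∃ (A B : ℕ → ℕ → Set X) (N : Set X),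
    μ N = 0 ∧
    (∀ n, A 0 n ⊆ Ω) ∧
    (∀ j n, MeasurableSet (A j n)) ∧
    (∀ j n, MeasurableSet (B (j + 1) n)) ∧
    (∀ j n, A j n ×ˢ B (j + 1) n ⊆ S) ∧
    (∀ j, ⋃ n, A (j + 1) n = ⋃ n ∈ posIndices μ (A j), B (j + 1) n) ∧
    Nᶜ = ⋃ j, ⋃ n ∈ posIndices μ (A j), A j n

/-- The integral `∫∫ Φ (x, y, (u x - u y) / lam) dμ(y) dμ(x)`. -/
noncomputable def energy (Φ : X → X → ℝ → ℝ≥0∞) (μ : Measure X) (u : X → ℝ) (lam : ℝ) : ℝ≥0∞ :=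
  ∫⁻ x, ∫⁻ y, Φ x y ((u x - u y) / lam) ∂μ ∂μ

theorem energy_congr (Φ : X → X → ℝ → ℝ≥0∞) (μ : Measure X) {u v : X → ℝ} (h : u =ᵐ[μ] v)
    (lam : ℝ) : energy Φ μ u lam = energy Φ μ v lam := by
  refine lintegral_congr_ae ?_
  filter_upwards [h] with x hx
  refine lintegral_congr_ae ?_
  filter_upwards [h] with y hy
  simp only [hx, hy]

namespace KernelCondition

variable {Φ : X → X → ℝ → ℝ≥0∞}

theorem mono (hΦ : KernelCondition Φ) (x y : X) {s t : ℝ} (h : |s| ≤ |t|) :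
    Φ x y s ≤ Φ x y t := by
  rcases eq_or_ne t 0 with rfl | ht
  · have : s = 0 := by simpa using h
    rw [this]
  have hst : |s / t| ≤ 1 := by
    rw [abs_div]; exact (div_le_one (abs_pos.2 ht)).2 h
  obtain ⟨h1, h2⟩ := abs_le.1 hst
  have ha : 0 ≤ (1 + s / t) / 2 := by linarith
  have hb : 0 ≤ (1 - s / t) / 2 := by linarith
  obtain ⟨a, ha'⟩ : ∃ a : ℝ≥0, (a : ℝ) = (1 + s / t) / 2 := ⟨⟨_, ha⟩, rfl⟩
  obtain ⟨b, hb'⟩ : ∃ b : ℝ≥0, (b : ℝ) = (1 - s / t) / 2 := ⟨⟨_, hb⟩, rfl⟩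
  have hab : a + b = 1 := by
    apply NNReal.eq
    rw [NNReal.coe_add, ha', hb', NNReal.coe_one]
    ring
  have key := (hΦ.convex x y).2 (Set.mem_univ t) (Set.mem_univ (-t)) (zero_le (a := a))
    (zero_le (a := b)) hab
  have e : a • t + b • (-t) = s := by
    rw [NNReal.smul_def, NNReal.smul_def, smul_eq_mul, smul_eq_mul, ha', hb']
    field_simp
    ring
  calc Φ x y s = Φ x y (a • t + b • (-t)) := by rw [e]
    _ ≤ a • Φ x y t + b • Φ x y (-t) := key
    _ = Φ x y t := by rw [hΦ.even, ← add_smul, hab, one_smul]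

theorem eq_iSup (hΦ : KernelCondition Φ) (x y : X) (s : ℝ) :
    Φ x y s = ⨆ q : ℚ, if |(q : ℝ)| < |s| then Φ x y q else 0 := by
  apply le_antisymm
  · refine le_of_forall_lt fun c hc => ?_
    have hs : s ≠ 0 := by
      rintro rfl
      rw [hΦ.zero] at hc
      exact not_lt_bot hc
    have hev : ∀ᶠ r in 𝓝 s, c < Φ x y r := hΦ.lsc x y s c hc
    obtain ⟨ε, hε, hball⟩ := Metric.eventually_nhds_iff.1 hev
    have hq : ∃ q : ℚ, |(q : ℝ)| < |s| ∧ dist (q : ℝ) s < ε := by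
      rcases lt_or_gt_of_ne hs with h | h
      · obtain ⟨q, hq1, hq2⟩ := exists_rat_btwn (show s < min 0 (s + ε) from
          lt_min h (by linarith))
        refine ⟨q, ?_, ?_⟩
        · rw [abs_of_neg h, abs_of_neg (lt_of_lt_of_le hq2 (min_le_left _ _))]; linarith
        · rw [Real.dist_eq, abs_of_pos (by linarith)]
          linarith [lt_of_lt_of_le hq2 (min_le_right _ _)]
      · obtain ⟨q, hq1, hq2⟩ := exists_rat_btwn (show max 0 (s - ε) < s from
          max_lt h (by linarith))
        refine ⟨q, ?_, ?_⟩
        · rw [abs_of_pos h, abs_of_pos (lt_of_le_of_lt (le_max_left _ _) hq1)]; linarith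
        · rw [Real.dist_eq, abs_of_neg (by linarith)]
          linarith [lt_of_le_of_lt (le_max_right _ _) hq1]
    obtain ⟨q, hq1, hq2⟩ := hq
    refine lt_of_lt_of_le (hball hq2) ?_
    refine le_trans ?_ (le_iSup _ q)
    simp [hq1]
  · refine iSup_le fun q => ?_
    split_ifs with h
    · exact hΦ.mono x y h.le
    · exact zero_le

theorem measurable_comp (hΦ : KernelCondition Φ) {w : X × X → ℝ} (hw : Measurable w) :
    Measurable fun p : X × X => Φ p.1 p.2 (w p) := by
  have : (fun p : X × X => Φ p.1 p.2 (w p)) =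
      fun p => ⨆ q : ℚ, if |(q : ℝ)| < |w p| then Φ p.1 p.2 q else 0 := by
    funext p
    exact hΦ.eq_iSup _ _ _
  rw [this]
  refine Measurable.iSup fun q => ?_
  refine Measurable.ite ?_ (hΦ.measurable q) measurable_const
  exact measurableSet_lt measurable_const (hw.abs)

theorem energy_eq_prod (hΦ : KernelCondition Φ) (μ : Measure X) [SigmaFinite μ] {u : X → ℝ}
    (hu : Measurable u) (lam : ℝ) :
    energy Φ μ u lam = ∫⁻ p : X × X, Φ p.1 p.2 ((u p.1 - u p.2) / lam) ∂(μ.prod μ) := by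
  rw [lintegral_prod]
  · rfl
  · exact (hΦ.measurable_comp (by fun_prop)).aemeasurable

theorem energy_convex (hΦ : KernelCondition Φ) (μ : Measure X) [SigmaFinite μ]
    (u v : X →ₘ[μ] ℝ) {a b : ℝ} (ha : 0 ≤ a) (hb : 0 ≤ b) (hab : a + b = 1) :
    energy Φ μ (a • u + b • v : X →ₘ[μ] ℝ) 1 ≤
      ENNReal.ofReal a * energy Φ μ u 1 + ENNReal.ofReal b * energy Φ μ v 1 := by
  have hu : Measurable u := u.measurable
  have hv : Measurable v := v.measurable
  have h1 : (⇑(a • u + b • v : X →ₘ[μ] ℝ)) =ᵐ[μ] fun x => a * u x + b * v x := by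
    filter_upwards [AEEqFun.coeFn_add (a • u) (b • v), AEEqFun.coeFn_smul a u,
      AEEqFun.coeFn_smul b v] with x h1 h2 h3
    simp [h1, h2, h3]
  have hu' : Measurable fun p : X × X => Φ p.1 p.2 ((u p.1 - u p.2) / 1) :=
    hΦ.measurable_comp (by fun_prop)
  have hv' : Measurable fun p : X × X => Φ p.1 p.2 ((v p.1 - v p.2) / 1) :=
    hΦ.measurable_comp (by fun_prop)
  rw [energy_congr Φ μ h1, hΦ.energy_eq_prod μ (by fun_prop), hΦ.energy_eq_prod μ hu,
    hΦ.energy_eq_prod μ hv, ← lintegral_const_mul _ hu', ← lintegral_const_mul _ hv',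
    ← lintegral_add_left (hu'.const_mul _)]
  refine lintegral_mono fun p => ?_
  lift a to ℝ≥0 using ha
  lift b to ℝ≥0 using hb
  have hab' : a + b = 1 := by exact_mod_cast hab
  have key := (hΦ.convex p.1 p.2).2 (Set.mem_univ ((u p.1 - u p.2) / 1))
    (Set.mem_univ ((v p.1 - v p.2) / 1)) (zero_le (a := a)) (zero_le (a := b)) hab'
  have e : (a * u p.1 + b * v p.1 - (a * u p.2 + b * v p.2)) / 1
      = a • ((u p.1 - u p.2) / 1) + b • ((v p.1 - v p.2) / 1) := by
    rw [NNReal.smul_def, NNReal.smul_def, smul_eq_mul, smul_eq_mul]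
    ring
  simp only [e, ENNReal.ofReal_coe_nnreal]
  exact key

theorem energy_smul (μ : Measure X) (u : X →ₘ[μ] ℝ) (c lam : ℝ) :
    energy Φ μ (c • u : X →ₘ[μ] ℝ) lam = energy Φ μ u (lam / c) := by
  rw [energy_congr Φ μ (AEEqFun.coeFn_smul c u)]
  unfold energy
  simp only [Pi.smul_apply, smul_eq_mul, div_div_eq_mul_div]
  congr! 6
  ring

theorem energy_neg (hΦ : KernelCondition Φ) (μ : Measure X) (u : X → ℝ) (lam : ℝ) :
    energy Φ μ u (-lam) = energy Φ μ u lam := by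
  unfold energy
  simp only [div_neg, hΦ.even]

theorem energy_zero (hΦ : KernelCondition Φ) (μ : Measure X) (lam : ℝ) :
    energy Φ μ (0 : X →ₘ[μ] ℝ) lam = 0 := by
  rw [energy_congr Φ μ (v := fun _ => 0) AEEqFun.coeFn_zero]
  simp [energy, hΦ.zero]

/-- For `0 ≤ a ≤ 1` the energy of `a u` is at most `a` times the energy of `u`. -/
theorem energy_smul_le (hΦ : KernelCondition Φ) (μ : Measure X) [SigmaFinite μ]
    (u : X →ₘ[μ] ℝ) {a : ℝ} (ha : 0 ≤ a) (ha1 : a ≤ 1) :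
    energy Φ μ (a • u : X →ₘ[μ] ℝ) 1 ≤ ENNReal.ofReal a * energy Φ μ u 1 := by
  have := hΦ.energy_convex μ u 0 ha (sub_nonneg.2 ha1) (by ring)
  simpa [hΦ.energy_zero μ] using this

end KernelCondition

/-- The space `W^{Φ,2}(X, Ω)` as a subspace of `L⁰(X)`: the (classes of) measurable functions `u`
with `∫∫ Φ (x, y, (u x - u y) / lam) dμ(y) dμ(x) < ∞` for some `lam > 0` and `u|_Ω ∈ L²(Ω)`. -/
noncomputable def sobolevSubmodule {Φ : X → X → ℝ → ℝ≥0∞} (hΦ : KernelCondition Φ) (μ : Measure X)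
    [SigmaFinite μ] (Ω : Set X) : Submodule ℝ (X →ₘ[μ] ℝ) where
  carrier := {u | (∃ lam : ℝ, 0 < lam ∧ energy Φ μ u lam < ∞) ∧ MemLp u 2 (μ.restrict Ω)}
  zero_mem' := by
    refine ⟨⟨1, one_pos, by rw [hΦ.energy_zero]; simp⟩, ?_⟩
    exact MemLp.zero.ae_eq (EventuallyEq.symm (ae_restrict_of_ae AEEqFun.coeFn_zero))
  add_mem' := by
    rintro u v ⟨⟨r, hr, hur⟩, hu⟩ ⟨⟨s, hs, hvs⟩, hv⟩
    refine ⟨⟨r + s, by positivity, ?_⟩, ?_⟩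
    · have e : (r + s)⁻¹ • (u + v) = (r / (r + s)) • (r⁻¹ • u) + (s / (r + s)) • (s⁻¹ • v) := by
        rw [smul_smul, smul_smul, smul_add]
        congr 2 <;> field_simp
      have h := hΦ.energy_convex μ (r⁻¹ • u) (s⁻¹ • v) (a := r / (r + s)) (b := s / (r + s))
        (by positivity) (by positivity) (by field_simp)
      rw [← e, KernelCondition.energy_smul, KernelCondition.energy_smul,
        KernelCondition.energy_smul] at h
      simp only [one_div, inv_inv] at h
      refine lt_of_le_of_lt h ?_
      exact ENNReal.add_lt_top.2 ⟨ENNReal.mul_lt_top ENNReal.ofReal_lt_top hur,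
        ENNReal.mul_lt_top ENNReal.ofReal_lt_top hvs⟩
    · exact (hu.add hv).ae_eq (EventuallyEq.symm (ae_restrict_of_ae (AEEqFun.coeFn_add u v)))
  smul_mem' := by
    rintro c u ⟨⟨r, hr, hur⟩, hu⟩
    refine ⟨?_, (hu.const_smul c).ae_eq
      (EventuallyEq.symm (ae_restrict_of_ae (AEEqFun.coeFn_smul c u)))⟩
    rcases lt_trichotomy c 0 with h | rfl | h
    · refine ⟨-c * r, mul_pos (neg_pos.2 h) hr, ?_⟩
      rw [KernelCondition.energy_smul]
      have : -c * r / c = -r := by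
        have := h.ne
        field_simp
      rwa [this, hΦ.energy_neg]
    · refine ⟨1, one_pos, ?_⟩
      rw [zero_smul, hΦ.energy_zero]
      simp
    · refine ⟨c * r, mul_pos h hr, ?_⟩
      rw [KernelCondition.energy_smul]
      have : c * r / c = r := by field_simp
      rwa [this]

/-- The space `W^{Φ,2}(X, Ω)`. -/
def SobolevSpace {Φ : X → X → ℝ → ℝ≥0∞} (hΦ : KernelCondition Φ) (μ : Measure X)
    [SigmaFinite μ] (Ω : Set X) : Type _ :=
  sobolevSubmodule hΦ μ Ω

section Space

variable {Φ : X → X → ℝ → ℝ≥0∞} {hΦ : KernelCondition Φ} {μ : Measure X} [SigmaFinite μ]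
  {Ω : Set X}

noncomputable instance : AddCommGroup (SobolevSpace hΦ μ Ω) :=
  inferInstanceAs (AddCommGroup (sobolevSubmodule hΦ μ Ω))

noncomputable instance : Module ℝ (SobolevSpace hΦ μ Ω) :=
  inferInstanceAs (Module ℝ (sobolevSubmodule hΦ μ Ω))

/-- The inclusion of `W^{Φ,2}(X, Ω)` into `L⁰(X)`. -/
noncomputable def toL0 : SobolevSpace hΦ μ Ω →ₗ[ℝ] (X →ₘ[μ] ℝ) :=
  (sobolevSubmodule hΦ μ Ω).subtype

theorem toL0_mem (u : SobolevSpace hΦ μ Ω) :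
    (∃ lam : ℝ, 0 < lam ∧ energy Φ μ (toL0 u) lam < ∞) ∧ MemLp (toL0 u) 2 (μ.restrict Ω) :=
  Subtype.property (p := fun v => v ∈ sobolevSubmodule hΦ μ Ω) u

/-- The Minkowski (Luxemburg) seminorm
`inf {lam > 0 : ∫∫ Φ (x, y, (u x - u y) / lam) dμ(y) dμ(x) ≤ 1}`. -/
noncomputable def minkowskiNorm (Φ : X → X → ℝ → ℝ≥0∞) (μ : Measure X) (u : X → ℝ) : ℝ :=
  sInf {lam : ℝ | 0 < lam ∧ energy Φ μ u lam ≤ 1}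

/-- The unit ball of the energy modular. -/
def modularBall (hΦ : KernelCondition Φ) (μ : Measure X) [SigmaFinite μ] (Ω : Set X) :
    Set (SobolevSpace hΦ μ Ω) :=
  {u | energy Φ μ (toL0 u) 1 ≤ 1}

theorem minkowskiNorm_eq_gauge (u : SobolevSpace hΦ μ Ω) :
    minkowskiNorm Φ μ (toL0 u) = gauge (modularBall hΦ μ Ω) u := by
  rw [gauge_def']
  unfold minkowskiNorm modularBall
  congr 1
  ext r
  simp only [Set.mem_ofPred_eq, Set.mem_Ioi, map_smul, KernelCondition.energy_smul, one_div, inv_inv]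

theorem modularBall_convex : Convex ℝ (modularBall hΦ μ Ω) := by
  intro u hu v hv a b ha hb hab
  have h := hΦ.energy_convex μ (toL0 u) (toL0 v) ha hb hab
  change energy Φ μ (toL0 (a • u + b • v)) 1 ≤ 1
  rw [map_add, map_smul, map_smul]
  refine h.trans ?_
  calc _ ≤ ENNReal.ofReal a * 1 + ENNReal.ofReal b * 1 := by gcongr <;> assumption
    _ = 1 := by rw [mul_one, mul_one, ← ENNReal.ofReal_add ha hb, hab, ENNReal.ofReal_one]

theorem modularBall_balanced : Balanced ℝ (modularBall hΦ μ Ω) := by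
  rintro a ha _ ⟨u, hu, rfl⟩
  change energy Φ μ (toL0 (a • u)) 1 ≤ 1
  rw [map_smul]
  have key : energy Φ μ (a • toL0 u : X →ₘ[μ] ℝ) 1 = energy Φ μ (|a| • toL0 u : X →ₘ[μ] ℝ) 1 := by
    rcases abs_choice a with h | h
    · rw [h]
    · rw [h, KernelCondition.energy_smul, KernelCondition.energy_smul, div_neg, hΦ.energy_neg]
  rw [key]
  refine (hΦ.energy_smul_le μ (toL0 u) (abs_nonneg a) ha).trans ?_
  refine mul_le_one' ?_ hu
  rw [ENNReal.ofReal_le_one]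
  exact ha

theorem modularBall_absorbent : Absorbent ℝ (modularBall hΦ μ Ω) := by
  intro u
  obtain ⟨⟨r, hr, hur⟩, -⟩ := toL0_mem u
  set M := (energy Φ μ (toL0 u) r).toReal with hM
  have hM0 : 0 ≤ M := ENNReal.toReal_nonneg
  have hmem : (r * (1 + M))⁻¹ • u ∈ modularBall hΦ μ Ω := by
    change energy Φ μ (toL0 ((r * (1 + M))⁻¹ • u)) 1 ≤ 1
    rw [map_smul, mul_inv, mul_comm, ← smul_smul]
    refine (hΦ.energy_smul_le μ (r⁻¹ • toL0 u) (by positivity)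
      (inv_le_one_of_one_le₀ (by linarith))).trans ?_
    rw [KernelCondition.energy_smul, one_div, inv_inv, ← ENNReal.ofReal_toReal hur.ne,
      ← ENNReal.ofReal_mul (by positivity), ENNReal.ofReal_le_one, ← hM, inv_mul_le_one₀
      (by positivity)]
    linarith
  have hpos : 0 < r * (1 + M) := by positivity
  refine absorbs_iff_norm.2 ⟨r * (1 + M), fun c hc => ?_⟩
  have hc0 : c ≠ 0 := by
    rintro rfl
    simp only [norm_zero] at hc
    linarith
  rw [Set.singleton_subset_iff, Set.mem_smul_set_iff_inv_smul_mem₀ hc0]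
  have e : c⁻¹ • u = (c⁻¹ * (r * (1 + M))) • ((r * (1 + M))⁻¹ • u) := by
    rw [smul_smul, mul_assoc, mul_inv_cancel₀ hpos.ne', mul_one]
  rw [e]
  refine modularBall_balanced.smul_mem ?_ hmem
  rw [norm_mul, norm_inv, Real.norm_of_nonneg hpos.le]
  exact inv_mul_le_one_of_le₀ hc (norm_nonneg c)

/-- The Minkowski seminorm as a seminorm on `W^{Φ,2}(X, Ω)`. -/
noncomputable def minkowskiSeminorm (hΦ : KernelCondition Φ) (μ : Measure X) [SigmaFinite μ]
    (Ω : Set X) : Seminorm ℝ (SobolevSpace hΦ μ Ω) :=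
  gaugeSeminorm modularBall_balanced modularBall_convex modularBall_absorbent

/-- `‖u‖ = ‖u|_Ω‖_{L²(Ω)} + inf {lam > 0 : ∫∫ Φ (x, y, (u x - u y) / lam) ≤ 1}`. -/
noncomputable def sobolevNorm (u : SobolevSpace hΦ μ Ω) : ℝ :=
  (eLpNorm (toL0 u) 2 (μ.restrict Ω)).toReal + minkowskiNorm Φ μ (toL0 u)

/-- The norm `sobolevNorm` as a seminorm on `W^{Φ,2}(X, Ω)`. -/
noncomputable def sobolevSeminorm (hΦ : KernelCondition Φ) (μ : Measure X) [SigmaFinite μ]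
    (Ω : Set X) : Seminorm ℝ (SobolevSpace hΦ μ Ω) :=
  Seminorm.of sobolevNorm
    (by
      intro u v
      have h1 := map_add_le_add (minkowskiSeminorm hΦ μ Ω) u v
      have h2 : (eLpNorm (toL0 (u + v)) 2 (μ.restrict Ω)).toReal ≤
          (eLpNorm (toL0 u) 2 (μ.restrict Ω)).toReal
            + (eLpNorm (toL0 v) 2 (μ.restrict Ω)).toReal := by
        obtain ⟨-, hu⟩ := toL0_mem u
        obtain ⟨-, hv⟩ := toL0_mem v
        rw [map_add, eLpNorm_congr_ae (ae_restrict_of_ae (AEEqFun.coeFn_add (toL0 u) (toL0 v))),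
          ← ENNReal.toReal_add hu.eLpNorm_ne_top hv.eLpNorm_ne_top]
        exact ENNReal.toReal_mono (ENNReal.add_ne_top.2 ⟨hu.eLpNorm_ne_top, hv.eLpNorm_ne_top⟩)
          (eLpNorm_add_le hu.1 hv.1 (by norm_num))
      unfold sobolevNorm
      rw [minkowskiNorm_eq_gauge, minkowskiNorm_eq_gauge, minkowskiNorm_eq_gauge]
      change gauge _ _ ≤ gauge _ _ + gauge _ _ at h1
      linarith)
    (by
      intro c u
      have h1 := map_smul_eq_mul (minkowskiSeminorm hΦ μ Ω) c u
      change gauge _ _ = _ * gauge _ _ at h1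
      unfold sobolevNorm
      rw [minkowskiNorm_eq_gauge, minkowskiNorm_eq_gauge, h1, map_smul,
        eLpNorm_congr_ae (ae_restrict_of_ae (AEEqFun.coeFn_smul c (toL0 u))),
        eLpNorm_const_smul, ENNReal.toReal_mul, toReal_enorm, mul_add])

noncomputable instance : SeminormedAddCommGroup (SobolevSpace hΦ μ Ω) :=
  (sobolevSeminorm hΦ μ Ω).toAddGroupSeminorm.toSeminormedAddCommGroup

theorem norm_def (u : SobolevSpace hΦ μ Ω) :
    ‖u‖ = (eLpNorm (toL0 u) 2 (μ.restrict Ω)).toReal +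
      sInf {lam : ℝ | 0 < lam ∧ energy Φ μ (toL0 u) lam ≤ 1} :=
  rfl

noncomputable instance : NormedSpace ℝ (SobolevSpace hΦ μ Ω) where
  norm_smul_le c u := (map_smul_eq_mul (sobolevSeminorm hΦ μ Ω) c u).le

end Space

end MusielakOrlicz

/-!
Write `a u (x, y) = u x - u y`, so that the energy of `u` is `∫∫ Φ (x, y, a u)`.

The first three assertions rest on one mechanism. Control of the energy at scale `2⁻ᵏ` by `2⁻ᵏ`
makes the differences `a u` small almost everywhere on the active set
(`KernelCondition.ae_abs_sub_le_of_energy_le`), control in `L²(Ω)` makes `u` small almost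
everywhere on `Ω`, and the thickness condition carries any property which holds almost everywhere
on `Ω`, and which passes from `x` to `y` for almost every active pair `(x, y)`, to almost all of
the space (`Thick.ae_of_propagates`). This gives definiteness of the norm and almost everywhere
convergence of subsequences; together with Fatou's lemma for the energy it gives completeness.

Reflexivity is proved without computing any dual space. By Helly's theorem, a normed space is
reflexive as soon as it carries a functional `I ≥ 0`, bounded on bounded sets, such that near
minimizers of `I` on decreasing sequences of bounded convex sets converge
(`surjective_inclusionInDoubleDual_of_near_minimizers`; for a power of a uniformly convex norm
this is the theorem of Milman and Pettis). Here `I` is the sum of `∫_Ω u²`, of the energy, and of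
`∫∫ w √(1 + (a u)²)` with an integrable weight `w` which is positive on the active set and for
which `w |s| ≤ Φ (s) + g`, `g` integrable. For a sequence `u k` of near minimizers, the convexity
gaps `t I (u k) + (1 - t) I (u m) - I (t u k + (1 - t) u m)`, and hence those of each of the three
parts, are small:

* the first part makes `u k` a Cauchy sequence in `L²(Ω)`;
* the strict convexity of `√(1 + s²)` makes `a (u k)` Cauchy almost everywhere on the active set
  (`ae_cauchySeq_of_lintegral_sqrt_gap`), so that `u k` converges almost everywhere to some `v` in
  the space, by thickness;
* the `Δ₂`-condition on `Φ*` gives `Φ (2 t s) ≤ t Φ (s) + H` for some `0 < t < 1` and `H`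
  integrable (`KernelCondition.exists_le_mul_add_of_deltaTwo_fenchelConj`). With this `t`, the gap
  of `Φ` between `a (u k)` and `a v` bounds `Φ (a (u k))` up to an integrable function
  (`KernelCondition.mul_le_gap_add`). The gaps tend to zero in `L¹` by Fatou's lemma, so dominated
  convergence shows that the energy of `u k - v` tends to zero at every scale
  (`KernelCondition.tendsto_lintegral_of_gap`).
-/

namespace MusielakOrlicz

/-! ### A criterion for reflexivity -/

section Reflexivity

variable {E : Type*} [SeminormedAddCommGroup E] [NormedSpace ℝ E]

/-- A form of Helly's theorem: on finitely many functionals, an element of the bidual is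
approximated by evaluation at a vector of at most the same norm. -/
theorem exists_norm_le_forall_abs_sub_le (ξ : StrongDual ℝ (StrongDual ℝ E))
    (F : Finset (StrongDual ℝ E)) {ε : ℝ} (hε : 0 < ε) :
    ∃ u : E, ‖u‖ ≤ ‖ξ‖ ∧ ∀ f ∈ F, |f u - ξ f| ≤ ε := by
  classical
  let T : E →L[ℝ] (F → ℝ) := ContinuousLinearMap.pi fun f => (f : StrongDual ℝ E)
  let p : F → ℝ := fun f => ξ f
  have hconv : Convex ℝ (closure (T '' Metric.closedBall 0 ‖ξ‖)) :=
    ((convex_closedBall 0 ‖ξ‖).linear_image T.toLinearMap).closure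
  by_cases hp : p ∈ closure (T '' Metric.closedBall 0 ‖ξ‖)
  · obtain ⟨_, ⟨u, hu, rfl⟩, hd⟩ := Metric.mem_closure_iff.1 hp ε hε
    refine ⟨u, by simpa using hu, fun f hf => ?_⟩
    have h := (dist_le_pi_dist p (T u) ⟨f, hf⟩).trans hd.le
    rw [dist_comm, Real.dist_eq] at h
    exact h
  · exfalso
    obtain ⟨g, s, hgs, hsg⟩ := geometric_hahn_banach_closed_point hconv isClosed_closure hp
    -- the separating functional, pulled back to `E`, violates the bound on `ξ`
    have hsum : ∀ y : F → ℝ, g y = ∑ f : F, y f * g (Pi.single f 1) := by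
      intro y
      conv_lhs => rw [pi_eq_sum_univ' y]
      simp [map_sum]
    set G : StrongDual ℝ E := ∑ f : F, g (Pi.single f 1) • (f : StrongDual ℝ E) with hG
    have hGT : ∀ u, G u = g (T u) := by
      intro u
      rw [hsum, hG]
      simp [T, mul_comm]
    have hGξ : ξ G = g p := by
      rw [hsum, hG]
      simp [p, mul_comm]
    have hGu : ∀ u : E, ‖u‖ ≤ ‖ξ‖ → G u < s := fun u hu => by
      rw [hGT]
      exact hgs _ (subset_closure ⟨u, by simpa using hu, rfl⟩)
    have hs0 : 0 < s := by simpa using hGu 0 (by rw [norm_zero]; exact norm_nonneg ξ)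
    have hbound : ‖ξ‖ * ‖G‖ ≤ s := by
      rcases eq_or_lt_of_le (norm_nonneg ξ) with h0 | h0
      · rw [← h0, zero_mul]; exact hs0.le
      · rw [mul_comm, ← le_div_iff₀ h0]
        refine G.opNorm_le_bound (by positivity) fun u => ?_
        rcases eq_or_lt_of_le (norm_nonneg u) with hu | hu
        · have := G.le_opNorm u
          rw [← hu, mul_zero] at this ⊢
          exact this
        · have hn : ‖(‖ξ‖ / ‖u‖) • u‖ = ‖ξ‖ := by
            rw [norm_smul, Real.norm_of_nonneg (by positivity), div_mul_cancel₀ _ hu.ne']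
          have h1 := hGu _ hn.le
          have h2 := hGu (-((‖ξ‖ / ‖u‖) • u)) (by rw [norm_neg, hn])
          rw [map_neg, map_smul, smul_eq_mul] at h2
          rw [map_smul, smul_eq_mul] at h1
          have h3 : ‖ξ‖ / ‖u‖ * |G u| ≤ s := by
            rw [← abs_of_pos (div_pos h0 hu), ← abs_mul]
            exact abs_le.2 ⟨by linarith, h1.le⟩
          rw [Real.norm_eq_abs]
          calc |G u| = (‖ξ‖ / ‖u‖ * |G u|) * ‖u‖ / ‖ξ‖ := by field_simp
            _ ≤ s * ‖u‖ / ‖ξ‖ := by gcongr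
            _ = s / ‖ξ‖ * ‖u‖ := by ring
    have := (le_abs_self _).trans (ξ.le_opNorm G)
    rw [hGξ] at this
    linarith

/-- If near minimizers of the functional `I`, bounded on bounded sets, on a decreasing sequence of
bounded convex sets always converge, then the space is reflexive: for `ξ` in the bidual, the sets
of those `u` in a ball which almost agree with `ξ` on finitely many functionals form a directed
family of convex sets, and near minimizers along a suitable sequence in this family converge to a
vector representing `ξ`. The tolerance `ε n` is arbitrary, so it may be chosen to decay as fast as
the application requires. -/
theorem surjective_inclusionInDoubleDual_of_near_minimizers (I : E → ℝ) (hI : ∀ u, 0 ≤ I u)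
    (hbdd : ∀ R : ℝ, ∃ M : ℝ, ∀ u, ‖u‖ ≤ R → I u ≤ M) (ε : ℕ → ℝ) (hε : ∀ n, 0 < ε n)
    (hlim : ∀ (C : ℕ → Set E) (d R : ℝ), Antitone C → (∀ n, Convex ℝ (C n)) →
      (∀ n, ∀ u ∈ C n, ‖u‖ ≤ R) → (∀ n, ∀ u ∈ C n, d ≤ I u + ε n) →
      ∀ u : ℕ → E, (∀ n, u n ∈ C n) → (∀ n, I (u n) ≤ d + ε n) → ∃ v, Tendsto u atTop (𝓝 v)) :
    Function.Surjective (NormedSpace.inclusionInDoubleDual ℝ E) := by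
  classical
  intro ξ
  let D : Finset (StrongDual ℝ E) × ℕ → Set E := fun i =>
    {u | ‖u‖ ≤ ‖ξ‖ ∧ ∀ f ∈ i.1, |f u - ξ f| ≤ 1 / ((i.2 : ℝ) + 1)}
  have hDne : ∀ i, (D i).Nonempty := fun i =>
    exists_norm_le_forall_abs_sub_le ξ i.1 (by positivity)
  have hDanti : Antitone D := by
    rintro i j ⟨h1, h2⟩ u ⟨hu, hf⟩
    refine ⟨hu, fun f hfi => (hf f (h1 hfi)).trans ?_⟩
    exact one_div_le_one_div_of_le (by positivity) (by gcongr)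
  have hDconv : ∀ i, Convex ℝ (D i) := by
    rintro i u ⟨hu, hfu⟩ v ⟨hv, hfv⟩ a b ha hb hab
    refine ⟨?_, fun f hf => ?_⟩
    · have := convex_closedBall (0 : E) ‖ξ‖ (by simpa using hu) (by simpa using hv) ha hb hab
      simpa using this
    · have e : f (a • u + b • v) - ξ f = a * (f u - ξ f) + b * (f v - ξ f) := by
        simp only [map_add, map_smul, smul_eq_mul]
        linear_combination ξ f * hab
      rw [e]
      calc |a * (f u - ξ f) + b * (f v - ξ f)|
          ≤ a * |f u - ξ f| + b * |f v - ξ f| := by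
            refine (abs_add_le _ _).trans ?_
            rw [abs_mul, abs_mul, abs_of_nonneg ha, abs_of_nonneg hb]
        _ ≤ a * (1 / ((i.2 : ℝ) + 1)) + b * (1 / ((i.2 : ℝ) + 1)) := by
            gcongr
            · exact hfu f hf
            · exact hfv f hf
        _ = 1 / ((i.2 : ℝ) + 1) := by rw [← add_mul, hab, one_mul]
  let m : Finset (StrongDual ℝ E) × ℕ → ℝ := fun i => sInf (I '' D i)
  have hbelow : ∀ i, BddBelow (I '' D i) := fun i => ⟨0, by rintro _ ⟨u, -, rfl⟩; exact hI u⟩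
  have hmle : ∀ i, ∀ u ∈ D i, m i ≤ I u := fun i u hu => csInf_le (hbelow i) ⟨u, hu, rfl⟩
  obtain ⟨M, hM⟩ := hbdd ‖ξ‖
  have hmbdd : BddAbove (Set.range m) := by
    refine ⟨M, ?_⟩
    rintro _ ⟨i, rfl⟩
    obtain ⟨u, hu⟩ := hDne i
    exact (hmle i u hu).trans (hM u hu.1)
  -- `m i` is the infimum of `I` on `D i`, and `d` the supremum of these infima
  set d := ⨆ i, m i with hd
  have hnear : ∀ i n, ∃ u ∈ D i, I u ≤ d + ε n := by
    intro i n
    have h1 : sInf (I '' D i) < d + ε n :=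
      lt_of_le_of_lt (le_ciSup hmbdd i) (lt_add_of_pos_right _ (hε n))
    obtain ⟨_, ⟨u, hu, rfl⟩, hlt⟩ := exists_lt_of_csInf_lt ((hDne i).image I) h1
    exact ⟨u, hu, hlt.le⟩
  have hex : ∀ n, ∃ i, d - ε n < m i := fun n =>
    exists_lt_of_lt_ciSup (by rw [← hd]; linarith [hε n])
  choose j hj using hex
  let i : ℕ → Finset (StrongDual ℝ E) × ℕ := fun n => partialSups j n
  have hCanti : Antitone fun n => D (i n) := fun a b hab => hDanti ((partialSups j).monotone hab)
  have hCd : ∀ n, ∀ u ∈ D (i n), d ≤ I u + ε n := by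
    intro n u hu
    have := hmle (j n) u (hDanti (le_partialSups j n) hu)
    linarith [hj n]
  have key := hlim (fun n => D (i n)) d ‖ξ‖ hCanti (fun n => hDconv _) (fun n u hu => hu.1) hCd
  choose u hu hIu using fun n => hnear (i n) n
  obtain ⟨v, hv⟩ := key u hu hIu
  refine ⟨v, ContinuousLinearMap.ext fun f => ?_⟩
  choose y hy hIy using fun n => hnear (i n ⊔ ({f}, n)) n
  -- interleaving the two sequences of near-minimizers shows that they have the same limit
  have hyC : ∀ n, y n ∈ D (i n) := fun n => hDanti le_sup_left (hy n)
  obtain ⟨v', hv'⟩ := key (fun n => if Even n then u n else y n)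
    (fun n => by split_ifs; exacts [hu n, hyC n])
    (fun n => by split_ifs; exacts [hIu n, hIy n])
  have hev : Tendsto (fun n : ℕ => 2 * n) atTop atTop :=
    tendsto_atTop_mono (fun n => by simp only [id]; omega) tendsto_id
  have hodd : Tendsto (fun n : ℕ => 2 * n + 1) atTop atTop :=
    tendsto_atTop_mono (fun n => by simp only [id]; omega) tendsto_id
  have h1 : Tendsto (fun n => f (u (2 * n))) atTop (𝓝 (f v)) :=
    (f.continuous.tendsto v).comp (hv.comp hev)
  have h2 : Tendsto (fun n => f (u (2 * n))) atTop (𝓝 (f v')) := by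
    refine ((f.continuous.tendsto v').comp (hv'.comp hev)).congr fun n => ?_
    simp
  have h3 : Tendsto (fun n => f (y (2 * n + 1))) atTop (𝓝 (f v')) := by
    refine ((f.continuous.tendsto v').comp (hv'.comp hodd)).congr fun n => ?_
    simp
  have h4 : Tendsto (fun n => f (y (2 * n + 1))) atTop (𝓝 (ξ f)) := by
    have h5 : Tendsto (fun n => f (y n)) atTop (𝓝 (ξ f)) := by
      rw [tendsto_iff_dist_tendsto_zero]
      refine squeeze_zero (fun _ => dist_nonneg) (fun n => ?_)
        (tendsto_one_div_add_atTop_nhds_zero_nat (𝕜 := ℝ))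
      rw [Real.dist_eq]
      exact (hDanti (le_sup_right (a := i n)) (hy n)).2 f (by simp)
    exact h5.comp hodd
  rw [NormedSpace.dual_def, tendsto_nhds_unique h1 h2, tendsto_nhds_unique h3 h4]

end Reflexivity

variable {X : Type*} [MeasurableSpace X]

/-! ### Propagation along a thick set -/

/-- A property which holds almost everywhere on `Ω`, and which passes from `x` to `y` for almost
every `(x, y)` in a thick set, holds almost everywhere. It need not be measurable. -/
theorem Thick.ae_of_propagates {μ : Measure X} [SFinite μ] {Ω : Set X} {S : Set (X × X)}
    (hthick : Thick μ Ω S) (hΩ : MeasurableSet Ω) {P : X → Prop}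
    (hP : ∀ᵐ x ∂μ.restrict Ω, P x)
    (hS : ∀ᵐ p ∂μ.prod μ, p ∈ S → P p.1 → P p.2) : ∀ᵐ x ∂μ, P x := by
  obtain ⟨A, B, N, hN, hA0, -, -, hAB, hU, hcover⟩ := hthick
  have hS' := Measure.ae_ae_of_ae_prod hS
  have key : ∀ j, ∀ᵐ x ∂μ, x ∈ ⋃ n, A j n → P x := by
    intro j
    induction j with
    | zero =>
      filter_upwards [(ae_restrict_iff' hΩ).1 hP] with x hx hxA
      obtain ⟨n, hn⟩ := Set.mem_iUnion.1 hxA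
      exact hx (hA0 n hn)
    | succ j ih =>
      have h : ∀ n, ∀ᵐ y ∂μ, n ∈ posIndices μ (A j) → y ∈ B (j + 1) n → P y := by
        intro n
        by_cases hn : n ∈ posIndices μ (A j)
        -- `A j n` has positive measure, so it contains a generic point `x` that satisfies `P`
        · have hfreq : ∃ᵐ x ∂μ, x ∈ A j n := frequently_ae_mem_iff.2 (ne_of_gt hn)
          obtain ⟨x, hxA, hxP, hx⟩ := (hfreq.and_eventually (ih.and hS')).exists
          filter_upwards [hx] with y hy _ hyB
          exact hy (hAB j n ⟨hxA, hyB⟩) (hxP (Set.mem_iUnion.2 ⟨n, hxA⟩))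
        · exact Eventually.of_forall fun y hn' => absurd hn' hn
      rw [hU]
      filter_upwards [ae_all_iff.2 h] with y hy hyU
      obtain ⟨n, hn, hyB⟩ := Set.mem_iUnion₂.1 hyU
      exact hy n hn hyB
  filter_upwards [ae_all_iff.2 key, measure_eq_zero_iff_ae_notMem.1 hN] with x hx hxN
  obtain ⟨j, hj⟩ := Set.mem_iUnion.1 (hcover ▸ hxN : x ∈ ⋃ j, ⋃ n ∈ posIndices μ (A j), A j n)
  obtain ⟨n, -, hn⟩ := Set.mem_iUnion₂.1 hj
  exact hx j (Set.mem_iUnion.2 ⟨n, hn⟩)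

theorem Thick.exists_tendsto_ae {μ : Measure X} [SFinite μ] {Ω : Set X} {S : Set (X × X)}
    (hthick : Thick μ Ω S) (hΩ : MeasurableSet Ω) {f : ℕ → X → ℝ} (hf : ∀ k, Measurable (f k))
    (hfΩ : ∀ᵐ x ∂μ.restrict Ω, CauchySeq fun k => f k x)
    (hfS : ∀ᵐ p ∂μ.prod μ, p ∈ S → CauchySeq fun k => f k p.1 - f k p.2) :
    ∃ v : X → ℝ, Measurable v ∧ ∀ᵐ x ∂μ, Tendsto (fun k => f k x) atTop (𝓝 (v x)) := by
  have h : ∀ᵐ x ∂μ, ∃ l, Tendsto (fun k => f k x) atTop (𝓝 l) := by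
    have := hthick.ae_of_propagates hΩ (P := fun x => CauchySeq fun k => f k x) hfΩ (by
      filter_upwards [hfS] with p hp hpS hp1
      have h := hp1.add (hp hpS).neg
      have e : ((fun k => f k p.1) + -fun k => f k p.1 - f k p.2) = fun k => f k p.2 := by
        funext k
        simp
      rwa [e] at h)
    filter_upwards [this] with x hx
    exact cauchySeq_tendsto_of_complete hx
  obtain ⟨v, hv, hlim⟩ := measurable_limit_of_tendsto_metrizable_ae
    (fun k => (hf k).aemeasurable) h
  exact ⟨v, hv, hlim⟩

/-! ### Auxiliary facts on convergence -/

theorem ae_prod_of_ae {μ : Measure X} [SFinite μ] {P : X → Prop} (h : ∀ᵐ x ∂μ, P x) :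
    ∀ᵐ p ∂μ.prod μ, P p.1 ∧ P p.2 :=
  (Measure.quasiMeasurePreserving_fst.ae h).and (Measure.quasiMeasurePreserving_snd.ae h)

theorem tendsto_zero_ae_of_tsum_lintegral_ne_top {α : Type*} [MeasurableSpace α] {ν : Measure α}
    {f : ℕ → α → ℝ≥0∞} (hf : ∀ k, Measurable (f k)) (h : ∑' k, ∫⁻ a, f k a ∂ν ≠ ∞) :
    ∀ᵐ a ∂ν, Tendsto (fun k => f k a) atTop (𝓝 0) := by
  rw [← lintegral_tsum fun k => (hf k).aemeasurable] at h
  filter_upwards [ae_lt_top (Measurable.tsum hf) h] with a ha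
  exact ENNReal.tendsto_atTop_zero_of_tsum_ne_top ha.ne

theorem cauchySeq_of_eventually_abs_sub_le {a : ℕ → ℝ} {C r : ℝ} (hr : r < 1)
    (h : ∀ᶠ k in atTop, |a (k + 1) - a k| ≤ C * r ^ k) : CauchySeq a := by
  obtain ⟨N, hN⟩ := eventually_atTop.1 h
  refine (cauchySeq_shift N).1 ?_
  refine cauchySeq_of_le_geometric r (C * r ^ N) hr fun k => ?_
  rw [dist_comm, Real.dist_eq, mul_assoc, ← pow_add, add_comm N k]
  have := hN (k + N) (by omega)
  rwa [show k + N + 1 = k + 1 + N by ring] at this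

/-! ### The energy -/

namespace KernelCondition

variable {Φ : X → X → ℝ → ℝ≥0∞}

theorem smul_le (hΦ : KernelCondition Φ) (x y : X) {a : ℝ} (ha : 0 ≤ a) (ha1 : a ≤ 1) (s : ℝ) :
    Φ x y (a * s) ≤ ENNReal.ofReal a * Φ x y s := by
  lift a to ℝ≥0 using ha
  have ha1' : a ≤ 1 := by exact_mod_cast ha1
  have key := (hΦ.convex x y).2 (Set.mem_univ s) (Set.mem_univ 0) (zero_le (a := a))
    (zero_le (a := 1 - a)) (add_tsub_cancel_of_le ha1')
  rw [smul_zero, add_zero, hΦ.zero, smul_zero, add_zero] at key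
  rw [ENNReal.ofReal_coe_nnreal]
  exact key

theorem convex_comb (hΦ : KernelCondition Φ) (x y : X) {a : ℝ} (ha : 0 ≤ a) (ha1 : a ≤ 1)
    (s t : ℝ) : Φ x y (a * s + (1 - a) * t) ≤
      ENNReal.ofReal a * Φ x y s + ENNReal.ofReal (1 - a) * Φ x y t := by
  have ha1' := sub_nonneg.2 ha1
  generalize hb : 1 - a = b at *
  have hab : a + b = 1 := by linarith
  lift a to ℝ≥0 using ha
  lift b to ℝ≥0 using ha1'
  rw [ENNReal.ofReal_coe_nnreal, ENNReal.ofReal_coe_nnreal]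
  exact (hΦ.convex x y).2 (Set.mem_univ s) (Set.mem_univ t) (zero_le (a := a))
    (zero_le (a := b)) (by exact_mod_cast hab)

theorem energy_le_mul (hΦ : KernelCondition Φ) (μ : Measure X) (u : X → ℝ) {r s : ℝ} (hr : 0 < r)
    (hrs : r ≤ s) : energy Φ μ u s ≤ ENNReal.ofReal (r / s) * energy Φ μ u r := by
  have hs : 0 < s := hr.trans_le hrs
  unfold energy
  rw [← lintegral_const_mul' _ _ ENNReal.ofReal_ne_top]
  refine lintegral_mono fun x => ?_
  dsimp only
  rw [← lintegral_const_mul' _ _ ENNReal.ofReal_ne_top]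
  refine lintegral_mono fun y => ?_
  have := hΦ.smul_le x y (a := r / s) (by positivity) ((div_le_one hs).2 hrs) ((u x - u y) / r)
  rwa [show r / s * ((u x - u y) / r) = (u x - u y) / s by field_simp] at this

theorem energy_anti (hΦ : KernelCondition Φ) (μ : Measure X) (u : X → ℝ) {r s : ℝ} (hr : 0 < r)
    (hrs : r ≤ s) : energy Φ μ u s ≤ energy Φ μ u r := by
  refine (hΦ.energy_le_mul μ u hr hrs).trans (mul_le_of_le_one_left' ?_)
  rw [ENNReal.ofReal_le_one]
  exact (div_le_one (hr.trans_le hrs)).2 hrs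

theorem le_liminf (hΦ : KernelCondition Φ) (x y : X) {s : ℕ → ℝ} {t : ℝ}
    (h : Tendsto s atTop (𝓝 t)) : Φ x y t ≤ liminf (fun m => Φ x y (s m)) atTop := by
  refine le_of_forall_lt fun c hc => ?_
  obtain ⟨c', hc', hc't⟩ := exists_between hc
  refine hc'.trans_le (le_liminf_of_le (by isBoundedDefault) ?_)
  filter_upwards [h.eventually (hΦ.lsc x y t c' hc't)] with m hm using hm.le

/-- Fatou's lemma for the energy. -/
theorem energy_le_liminf (hΦ : KernelCondition Φ) (μ : Measure X) [SigmaFinite μ]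
    {w : ℕ → X → ℝ} {v : X → ℝ} (hw : ∀ m, Measurable (w m)) (hv : Measurable v)
    (h : ∀ᵐ x ∂μ, Tendsto (fun m => w m x) atTop (𝓝 (v x))) (lam : ℝ) :
    energy Φ μ v lam ≤ liminf (fun m => energy Φ μ (w m) lam) atTop := by
  rw [hΦ.energy_eq_prod μ hv]
  simp_rw [hΦ.energy_eq_prod μ (hw _)]
  refine le_trans (lintegral_mono_ae ?_) (lintegral_liminf_le fun m =>
    hΦ.measurable_comp (w := fun p => (w m p.1 - w m p.2) / lam) (by have := hw m; fun_prop))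
  filter_upwards [ae_prod_of_ae h] with p hp
  exact hΦ.le_liminf _ _ ((hp.1.sub hp.2).div_const lam)

/-- The integrals of `Φ (x, y, 2ᵏ (w k x - w k y))` are summable, so the integrands tend to zero
almost everywhere, and are eventually smaller than a nonzero value `Φ (x, y, s)`. -/
theorem ae_abs_sub_le_of_energy_le (hΦ : KernelCondition Φ) (μ : Measure X) [SigmaFinite μ]
    {w : ℕ → X → ℝ} (hw : ∀ m, Measurable (w m))
    (h : ∀ k, energy Φ μ (w k) ((1 / 2) ^ k) ≤ ENNReal.ofReal ((1 / 2) ^ k)) :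
    ∀ᵐ p ∂μ.prod μ, p ∈ activeSet Φ →
      ∃ C : ℝ, ∀ᶠ k in atTop, |w k p.1 - w k p.2| ≤ C * (1 / 2) ^ k := by
  simp_rw [hΦ.energy_eq_prod μ (hw _)] at h
  have hsum : ∑' k, ∫⁻ p, Φ p.1 p.2 ((w k p.1 - w k p.2) / (1 / 2) ^ k) ∂μ.prod μ ≠ ∞ := by
    refine ne_top_of_le_ne_top ?_ (ENNReal.tsum_le_tsum h)
    rw [← ENNReal.ofReal_tsum_of_nonneg (fun _ => by positivity) summable_geometric_two]
    exact ENNReal.ofReal_ne_top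
  filter_upwards [tendsto_zero_ae_of_tsum_lintegral_ne_top (fun k => hΦ.measurable_comp
    (w := fun p => (w k p.1 - w k p.2) / (1 / 2) ^ k) (by have := hw k; fun_prop)) hsum]
    with p hp hpS
  obtain ⟨s, hs⟩ : ∃ s, Φ p.1 p.2 s ≠ 0 := by simpa [activeSet] using hpS
  refine ⟨|s|, ?_⟩
  filter_upwards [hp.eventually_lt_const (pos_iff_ne_zero.2 hs)] with k hk
  by_contra! hlt
  refine absurd hk (not_lt.2 (hΦ.mono _ _ ?_))
  rw [abs_div, abs_of_pos (by positivity : (0 : ℝ) < (1 / 2) ^ k), le_div_iff₀ (by positivity)]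
  exact hlt.le

theorem apply_sub_eq_zero_of_energy (hΦ : KernelCondition Φ) (μ : Measure X) [SigmaFinite μ]
    {w : X → ℝ} (hw : Measurable w) (h : ∀ r : ℝ, 0 < r → energy Φ μ w r ≤ 1) :
    ∀ᵐ p ∂μ.prod μ, p ∈ activeSet Φ → w p.1 = w p.2 := by
  have h' : ∀ k : ℕ, energy Φ μ w ((1 / 2) ^ k) ≤ ENNReal.ofReal ((1 / 2) ^ k) := fun k => by
    refine (hΦ.energy_le_mul μ w (r := (1 / 2) ^ k * (1 / 2) ^ k) (by positivity)
      (mul_le_of_le_one_left (by positivity)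
        (pow_le_one₀ (by norm_num) (by norm_num)))).trans ?_
    rw [mul_div_assoc, div_self (by positivity), mul_one]
    exact mul_le_of_le_one_right' (h _ (by positivity))
  filter_upwards [hΦ.ae_abs_sub_le_of_energy_le μ (fun _ : ℕ => hw) h'] with p hp hpS
  obtain ⟨C, hC⟩ := hp hpS
  have h0 : Tendsto (fun k : ℕ => C * (1 / 2 : ℝ) ^ k) atTop (𝓝 0) := by
    simpa using (tendsto_pow_atTop_nhds_zero_of_lt_one (r := (1 / 2 : ℝ)) (by norm_num)
      (by norm_num)).const_mul C
  have := ge_of_tendsto h0 hC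
  exact sub_eq_zero.1 (abs_nonpos_iff.1 this)

end KernelCondition

/-! ### Estimates in terms of the norm -/

section Space

variable {Φ : X → X → ℝ → ℝ≥0∞} {hΦ : KernelCondition Φ} {μ : Measure X} [SigmaFinite μ]
  {Ω : Set X}

theorem toL0_sub_ae (u v : SobolevSpace hΦ μ Ω) :
    toL0 (u - v) =ᵐ[μ] fun x => toL0 u x - toL0 v x := by
  rw [map_sub]
  exact AEEqFun.coeFn_sub _ _

theorem energy_toL0_le_one (u : SobolevSpace hΦ μ Ω) {r : ℝ} (h : ‖u‖ < r) :
    energy Φ μ (toL0 u) r ≤ 1 := by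
  have hne : {lam : ℝ | 0 < lam ∧ energy Φ μ (toL0 u) lam ≤ 1}.Nonempty := by
    obtain ⟨⟨s, hs, hlt⟩, -⟩ := toL0_mem u
    set M := (energy Φ μ (toL0 u) s).toReal with hM
    have hM0 : 0 ≤ M := ENNReal.toReal_nonneg
    refine ⟨s * (1 + M), by positivity, (hΦ.energy_le_mul μ _ hs ?_).trans ?_⟩
    · exact le_mul_of_one_le_right hs.le (by linarith)
    · rw [← ENNReal.ofReal_toReal hlt.ne, ← ENNReal.ofReal_mul (by positivity),
        ENNReal.ofReal_le_one, ← hM]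
      rw [div_mul_eq_mul_div, div_le_one (by positivity)]
      nlinarith
  have h1 : sInf {lam : ℝ | 0 < lam ∧ energy Φ μ (toL0 u) lam ≤ 1} < r := by
    refine lt_of_le_of_lt ?_ h
    rw [norm_def]
    exact le_add_of_nonneg_left ENNReal.toReal_nonneg
  obtain ⟨s, ⟨hs0, hs⟩, hsr⟩ := exists_lt_of_csInf_lt hne h1
  exact (hΦ.energy_anti μ _ hs0 hsr.le).trans hs

theorem eLpNorm_toL0_le (u : SobolevSpace hΦ μ Ω) :
    eLpNorm (toL0 u) 2 (μ.restrict Ω) ≤ ENNReal.ofReal ‖u‖ := by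
  rw [← ENNReal.ofReal_toReal (toL0_mem u).2.eLpNorm_ne_top]
  refine ENNReal.ofReal_le_ofReal ?_
  rw [norm_def]
  exact le_add_of_nonneg_right (Real.sInf_nonneg fun r hr => hr.1.le)

/-- A converse to `energy_toL0_le_one` and `eLpNorm_toL0_le`. -/
theorem norm_le_of_le (u : SobolevSpace hΦ μ Ω) {r : ℝ} (hr : 0 < r)
    (h1 : eLpNorm (toL0 u) 2 (μ.restrict Ω) ≤ ENNReal.ofReal r)
    (h2 : energy Φ μ (toL0 u) r ≤ 1) : ‖u‖ ≤ 2 * r := by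
  rw [norm_def, two_mul]
  refine add_le_add (ENNReal.toReal_le_of_le_ofReal hr.le h1) (csInf_le ⟨0, ?_⟩ ⟨hr, h2⟩)
  rintro s hs
  exact hs.1.le

theorem eq_zero_of_toL0_ae {u : SobolevSpace hΦ μ Ω} (h : ∀ᵐ x ∂μ, toL0 u x = 0) : u = 0 := by
  have h1 : toL0 u = 0 := AEEqFun.ext (by
    filter_upwards [h, AEEqFun.coeFn_zero (μ := μ) (β := ℝ) (α := X)] with x hx h0
    rw [hx, h0]; rfl)
  exact (Submodule.subtype_injective (sobolevSubmodule hΦ μ Ω)) (h1.trans (map_zero toL0).symm)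

theorem exists_toL0_ae_eq {v : X → ℝ} (hv : Measurable v)
    (h1 : ∃ lam : ℝ, 0 < lam ∧ energy Φ μ v lam < ∞) (h2 : MemLp v 2 (μ.restrict Ω)) :
    ∃ u : SobolevSpace hΦ μ Ω, toL0 u =ᵐ[μ] v := by
  have hae : AEEqFun.mk v hv.aestronglyMeasurable =ᵐ[μ] v := AEEqFun.coeFn_mk _ _
  obtain ⟨r, hr, hlt⟩ := h1
  exact ⟨(⟨AEEqFun.mk v hv.aestronglyMeasurable,
    ⟨r, hr, by rwa [energy_congr Φ μ hae]⟩, h2.ae_eq (ae_restrict_of_ae hae.symm)⟩ :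
      sobolevSubmodule hΦ μ Ω), hae⟩

end Space

/-! ### Definiteness, almost everywhere convergence and completeness -/

theorem lintegral_ofReal_sq {α : Type*} [MeasurableSpace α] {ν : Measure α} (f : α → ℝ) :
    ∫⁻ x, ENNReal.ofReal (f x ^ 2) ∂ν = eLpNorm f 2 ν ^ 2 := by
  have h := eLpNorm_nnreal_pow_eq_lintegral (f := f) (μ := ν) (p := 2) (by norm_num)
  simp only [NNReal.coe_ofNat, ENNReal.rpow_ofNat, ENNReal.coe_ofNat] at h
  rw [h]
  refine lintegral_congr fun x => ?_
  rw [← ofReal_norm, ← ENNReal.ofReal_pow (norm_nonneg _), Real.norm_eq_abs, sq_abs]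

theorem ae_abs_le_of_eLpNorm_two_le {α : Type*} [MeasurableSpace α] {ν : Measure α}
    {f : ℕ → α → ℝ} (hf : ∀ k, Measurable (f k))
    (h : ∀ k, eLpNorm (f k) 2 ν ≤ ENNReal.ofReal ((1 / 4) ^ k)) :
    ∀ᵐ x ∂ν, ∀ᶠ k in atTop, |f k x| ≤ (1 / 2) ^ k := by
  have hle : ∀ k, ∫⁻ x, ENNReal.ofReal ((2 ^ k * f k x) ^ 2) ∂ν
      ≤ ENNReal.ofReal ((1 / 2) ^ k) := by
    intro k
    rw [lintegral_ofReal_sq, show (fun x => (2 : ℝ) ^ k * f k x) = (2 : ℝ) ^ k • f k from rfl,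
      eLpNorm_const_smul, Real.enorm_of_nonneg (by positivity)]
    calc (ENNReal.ofReal (2 ^ k) * eLpNorm (f k) 2 ν) ^ 2
        ≤ (ENNReal.ofReal (2 ^ k) * ENNReal.ofReal ((1 / 4) ^ k)) ^ 2 := by gcongr; exact h k
      _ = ENNReal.ofReal ((1 / 4) ^ k) := by
          rw [← ENNReal.ofReal_mul (by positivity), ← mul_pow,
            ← ENNReal.ofReal_pow (by positivity), ← pow_mul, mul_comm k, pow_mul]
          norm_num
      _ ≤ ENNReal.ofReal ((1 / 2) ^ k) :=
          ENNReal.ofReal_le_ofReal (pow_le_pow_left₀ (by norm_num) (by norm_num) k)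
  have hsum : ∑' k, ∫⁻ x, ENNReal.ofReal ((2 ^ k * f k x) ^ 2) ∂ν ≠ ∞ := by
    refine ne_top_of_le_ne_top ?_ (ENNReal.tsum_le_tsum hle)
    rw [← ENNReal.ofReal_tsum_of_nonneg (fun _ => by positivity) summable_geometric_two]
    exact ENNReal.ofReal_ne_top
  filter_upwards [tendsto_zero_ae_of_tsum_lintegral_ne_top
    (fun k => by have := hf k; fun_prop) hsum] with x hx
  filter_upwards [hx.eventually_lt_const zero_lt_one] with k hk
  rw [ENNReal.ofReal_lt_one, sq_lt_one_iff_abs_lt_one, abs_mul, abs_of_pos (by positivity)] at hk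
  rw [one_div, inv_pow, ← one_div, le_div_iff₀ (by positivity), mul_comm]
  exact hk.le

theorem tendsto_zero_of_abs_le_geometric {a : ℕ → ℝ} {C : ℝ}
    (h : ∀ᶠ k in atTop, |a k| ≤ C * (1 / 2) ^ k) : Tendsto a atTop (𝓝 0) := by
  refine squeeze_zero_norm' h ?_
  simpa using (tendsto_pow_atTop_nhds_zero_of_lt_one (r := (1 / 2 : ℝ)) (by norm_num)
      (by norm_num)).const_mul C

section Space

variable {Φ : X → X → ℝ → ℝ≥0∞} {hΦ : KernelCondition Φ} {μ : Measure X} [SigmaFinite μ]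
  {Ω : Set X}

theorem energy_toL0_geometric {w : SobolevSpace hΦ μ Ω} {k : ℕ} (hw : ‖w‖ < (1 / 4) ^ k) :
    energy Φ μ (toL0 w) ((1 / 2) ^ k) ≤ ENNReal.ofReal ((1 / 2) ^ k) := by
  refine (hΦ.energy_le_mul μ _ (r := (1 / 4) ^ k) (by positivity)
    (pow_le_pow_left₀ (by norm_num) (by norm_num) k)).trans ?_
  rw [← div_pow, show (1 / 4 / (1 / 2) : ℝ) = 1 / 2 by norm_num]
  exact mul_le_of_le_one_right' (energy_toL0_le_one w hw)

theorem ae_abs_toL0_le (w : ℕ → SobolevSpace hΦ μ Ω) (hw : ∀ k, ‖w k‖ < (1 / 4) ^ k) :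
    (∀ᵐ x ∂μ.restrict Ω, ∀ᶠ k in atTop, |toL0 (w k) x| ≤ (1 / 2) ^ k) ∧
    ∀ᵐ p ∂μ.prod μ, p ∈ activeSet Φ → ∃ C : ℝ, ∀ᶠ k in atTop,
      |toL0 (w k) p.1 - toL0 (w k) p.2| ≤ C * (1 / 2) ^ k :=
  ⟨ae_abs_le_of_eLpNorm_two_le (fun k => (toL0 (w k)).measurable) fun k =>
      (eLpNorm_toL0_le _).trans (ENNReal.ofReal_le_ofReal (hw k).le),
    hΦ.ae_abs_sub_le_of_energy_le μ (fun k => (toL0 (w k)).measurable) fun k =>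
      energy_toL0_geometric (hw k)⟩

theorem eq_zero_of_norm_eq_zero (hΩ : MeasurableSet Ω) (hthick : Thick μ Ω (activeSet Φ))
    (u : SobolevSpace hΦ μ Ω) (hu : ‖u‖ = 0) : u = 0 := by
  refine eq_zero_of_toL0_ae (hthick.ae_of_propagates hΩ ?_ ?_)
  · have h := eLpNorm_toL0_le u
    rw [hu, ENNReal.ofReal_zero, nonpos_iff_eq_zero,
      eLpNorm_eq_zero_iff (toL0 u).measurable.aestronglyMeasurable (by norm_num)] at h
    exact h
  · filter_upwards [hΦ.apply_sub_eq_zero_of_energy μ (toL0 u).measurable fun r hr =>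
      energy_toL0_le_one u (by rwa [hu])] with p hp hpS h1
    rw [← hp hpS, h1]

theorem exists_subseq_tendsto_ae (hΩ : MeasurableSet Ω) (hthick : Thick μ Ω (activeSet Φ))
    (u : ℕ → SobolevSpace hΦ μ Ω) (v : SobolevSpace hΦ μ Ω) (huv : Tendsto u atTop (𝓝 v)) :
    ∃ φ : ℕ → ℕ, StrictMono φ ∧
      ∀ᵐ x ∂μ, Tendsto (fun k => toL0 (u (φ k)) x) atTop (𝓝 (toL0 v x)) := by
  have hev : ∀ k : ℕ, ∀ᶠ n in atTop, ‖u n - v‖ < (1 / 4) ^ k := fun k => by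
    simpa [dist_eq_norm] using Metric.tendsto_nhds.1 huv ((1 / 4) ^ k) (by positivity)
  obtain ⟨φ, hφ, hφn⟩ := extraction_forall_of_eventually hev
  refine ⟨φ, hφ, ?_⟩
  obtain ⟨h1, h2⟩ := ae_abs_toL0_le (fun k => u (φ k) - v) hφn
  have h3 := hthick.ae_of_propagates hΩ
    (P := fun x => Tendsto (fun k => toL0 (u (φ k) - v) x) atTop (𝓝 0))
    (by
      filter_upwards [h1] with x hx
      exact tendsto_zero_of_abs_le_geometric (C := 1) (by simpa using hx))
    (by
      filter_upwards [h2] with p hp hpS hp1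
      obtain ⟨C, hC⟩ := hp hpS
      simpa using hp1.sub (tendsto_zero_of_abs_le_geometric hC))
  filter_upwards [h3, ae_all_iff.2 fun k => toL0_sub_ae (u (φ k)) v] with x hx hsub
  simp only [hsub] at hx
  simpa using hx.add_const (toL0 v x)

/-- A bounded sequence that is Cauchy almost everywhere on `Ω`, and whose differences are Cauchy
almost everywhere on the active set, has an almost everywhere limit in `W^{Φ,2}(X, Ω)`. -/
theorem exists_toL0_tendsto_ae (hΩ : MeasurableSet Ω) (hthick : Thick μ Ω (activeSet Φ))
    (u : ℕ → SobolevSpace hΦ μ Ω) {R : ℝ} (hR : ∀ k, ‖u k‖ < R)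
    (huΩ : ∀ᵐ x ∂μ.restrict Ω, CauchySeq fun k => toL0 (u k) x)
    (huS : ∀ᵐ p ∂μ.prod μ, p ∈ activeSet Φ →
      CauchySeq fun k => toL0 (u k) p.1 - toL0 (u k) p.2) :
    ∃ v : SobolevSpace hΦ μ Ω,
      ∀ᵐ x ∂μ, Tendsto (fun k => toL0 (u k) x) atTop (𝓝 (toL0 v x)) := by
  have hR0 : 0 < R := (norm_nonneg _).trans_lt (hR 0)
  obtain ⟨v, hv, hlim⟩ := hthick.exists_tendsto_ae hΩ (fun k => (toL0 (u k)).measurable) huΩ huS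
  have h1 : energy Φ μ v R ≤ 1 := by
    refine (hΦ.energy_le_liminf μ (fun k => (toL0 (u k)).measurable) hv hlim R).trans ?_
    exact liminf_le_of_le (by isBoundedDefault) fun b hb =>
      let ⟨k, hk⟩ := hb.exists
      hk.trans (energy_toL0_le_one _ (hR k))
  have h2 : eLpNorm v 2 (μ.restrict Ω) ≤ ENNReal.ofReal R := by
    refine (Lp.eLpNorm_lim_le_liminf_eLpNorm
      (fun k => (toL0 (u k)).measurable.aestronglyMeasurable) v (ae_restrict_of_ae hlim)).trans ?_
    exact liminf_le_of_le (by isBoundedDefault) fun b hb =>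
      let ⟨k, hk⟩ := hb.exists
      hk.trans ((eLpNorm_toL0_le _).trans (ENNReal.ofReal_le_ofReal (hR k).le))
  obtain ⟨w, hw⟩ := exists_toL0_ae_eq (hΦ := hΦ) (Ω := Ω) hv
    ⟨R, hR0, h1.trans_lt ENNReal.one_lt_top⟩
    ⟨hv.aestronglyMeasurable, h2.trans_lt ENNReal.ofReal_lt_top⟩
  refine ⟨w, ?_⟩
  filter_upwards [hlim, hw] with x hx hwx
  rwa [hwx]

/-- The norm is lower semicontinuous under almost everywhere convergence, up to the factor `2` which
comes from bounding its two parts separately. -/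
theorem norm_le_of_toL0_tendsto_ae (w : ℕ → SobolevSpace hΦ μ Ω) (v : SobolevSpace hΦ μ Ω)
    (hlim : ∀ᵐ x ∂μ, Tendsto (fun k => toL0 (w k) x) atTop (𝓝 (toL0 v x))) {r : ℝ} (hr : 0 < r)
    (hw : ∀ᶠ k in atTop, ‖w k‖ < r) : ‖v‖ ≤ 2 * r := by
  refine norm_le_of_le v hr ?_ ?_
  · refine (Lp.eLpNorm_lim_le_liminf_eLpNorm
      (fun k => (toL0 (w k)).measurable.aestronglyMeasurable) _ (ae_restrict_of_ae hlim)).trans ?_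
    exact liminf_le_of_le (by isBoundedDefault) fun b hb =>
      let ⟨k, hk, hkr⟩ := (hb.and hw).exists
      hk.trans ((eLpNorm_toL0_le _).trans (ENNReal.ofReal_le_ofReal hkr.le))
  · refine (hΦ.energy_le_liminf μ (fun k => (toL0 (w k)).measurable) (toL0 v).measurable
      hlim r).trans ?_
    exact liminf_le_of_le (by isBoundedDefault) fun b hb =>
      let ⟨k, hk, hkr⟩ := (hb.and hw).exists
      hk.trans (energy_toL0_le_one _ hkr)

theorem completeSpace_of_thick (hΩ : MeasurableSet Ω) (hthick : Thick μ Ω (activeSet Φ)) :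
    CompleteSpace (SobolevSpace hΦ μ Ω) := by
  refine Metric.complete_of_convergent_controlled_sequences (fun k => (1 / 4) ^ k)
    (fun k => by positivity) fun u hu => ?_
  simp only [dist_eq_norm] at hu
  obtain ⟨h1, h2⟩ := ae_abs_toL0_le (fun k => u (k + 1) - u k)
    (fun k => hu k (k + 1) k (by omega) le_rfl)
  have hsub := ae_all_iff.2 fun k => toL0_sub_ae (u (k + 1)) (u k)
  obtain ⟨v, hv⟩ := exists_toL0_tendsto_ae hΩ hthick u (R := ‖u 0‖ + 1)
    (fun k => by
      have h3 := hu 0 k 0 (Nat.zero_le k) le_rfl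
      have h4 := norm_sub_norm_le (u k) (u 0)
      rw [pow_zero] at h3
      linarith)
    (by
      filter_upwards [h1, ae_restrict_of_ae hsub] with x hx hs
      refine cauchySeq_of_eventually_abs_sub_le (C := 1) (r := 1 / 2) (by norm_num) ?_
      filter_upwards [hx] with k hk
      rwa [hs, ← one_mul ((1 / 2 : ℝ) ^ k)] at hk)
    (by
      filter_upwards [h2, ae_prod_of_ae hsub] with p hp hs hpS
      obtain ⟨C, hC⟩ := hp hpS
      refine cauchySeq_of_eventually_abs_sub_le (C := C) (r := 1 / 2) (by norm_num) ?_
      filter_upwards [hC] with k hk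
      rw [hs.1, hs.2] at hk
      convert hk using 2
      ring)
  refine ⟨v, ?_⟩
  rw [tendsto_iff_norm_sub_tendsto_zero]
  refine squeeze_zero (fun _ => norm_nonneg _) (g := fun k => 2 * (1 / 4) ^ k) (fun k => ?_) ?_
  · rw [norm_sub_rev]
    refine norm_le_of_toL0_tendsto_ae (fun m => u m - u k) (v - u k) ?_ (by positivity) ?_
    · filter_upwards [hv, ae_all_iff.2 fun m => toL0_sub_ae (u m) (u k),
        toL0_sub_ae v (u k)] with x hx hs hs'
      simp only [hs, hs']
      exact hx.sub_const _
    · filter_upwards [eventually_ge_atTop k] with m hm using hu k m k hm le_rfl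
  · simpa using (tendsto_pow_atTop_nhds_zero_of_lt_one (r := (1 / 4 : ℝ)) (by norm_num)
      (by norm_num)).const_mul 2

end Space

/-! ### Consequences of the two growth conditions -/

/-- The `Δ₂`-condition bounds `Φ (r s)` for every factor `r`, not only for `r = 2`. -/
theorem DeltaTwo.exists_le_mul_add {Φ : X → X → ℝ → ℝ≥0∞} {μ : Measure X}
    (hΔ : DeltaTwo μ Φ) (hΦ : KernelCondition Φ) (r : ℝ) :
    ∃ (K : ℝ≥0∞) (H : X × X → ℝ≥0∞), K ≠ ∞ ∧ AEMeasurable H (μ.prod μ) ∧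
      ∫⁻ p, H p ∂μ.prod μ ≠ ∞ ∧ (∀ p, H p ≠ ∞) ∧
      ∀ p s, Φ p.1 p.2 (r * s) ≤ K * Φ p.1 p.2 s + H p := by
  obtain ⟨K, h, hK, h0, hint, hle⟩ := hΔ
  set h' : X × X → ℝ≥0∞ := fun p => ENNReal.ofReal (h p.1 p.2) with hh'
  have hm : AEMeasurable h' (μ.prod μ) := hint.1.aemeasurable.ennreal_ofReal
  have hfin : ∫⁻ p, h' p ∂μ.prod μ ≠ ∞ := by
    rw [← ofReal_integral_eq_lintegral_ofReal hint (Eventually.of_forall fun p => h0 _ _)]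
    exact ENNReal.ofReal_ne_top
  have hpow : ∀ n : ℕ, ∃ (K : ℝ≥0∞) (H : X × X → ℝ≥0∞), K ≠ ∞ ∧ AEMeasurable H (μ.prod μ) ∧
      ∫⁻ p, H p ∂μ.prod μ ≠ ∞ ∧ (∀ p, H p ≠ ∞) ∧
      ∀ p s, Φ p.1 p.2 (2 ^ n * s) ≤ K * Φ p.1 p.2 s + H p := by
    intro n
    induction n with
    | zero => exact ⟨1, 0, by simp, aemeasurable_const, by simp, by simp, by simp⟩
    | succ n ih =>
      obtain ⟨K', H, hK', hHm, hHi, hHt, hH⟩ := ih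
      refine ⟨ENNReal.ofReal K * K', fun p => ENNReal.ofReal K * H p + h' p,
        ENNReal.mul_ne_top ENNReal.ofReal_ne_top hK', (hHm.const_mul _).add hm, ?_, fun p =>
        ENNReal.add_ne_top.2 ⟨ENNReal.mul_ne_top ENNReal.ofReal_ne_top (hHt p),
          ENNReal.ofReal_ne_top⟩, fun p s => ?_⟩
      · rw [lintegral_add_right' _ hm, lintegral_const_mul' _ _ ENNReal.ofReal_ne_top]
        exact ENNReal.add_ne_top.2 ⟨ENNReal.mul_ne_top ENNReal.ofReal_ne_top hHi, hfin⟩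
      · calc Φ p.1 p.2 (2 ^ (n + 1) * s) = Φ p.1 p.2 (2 * (2 ^ n * s)) := by
              rw [pow_succ, mul_comm _ (2 : ℝ), mul_assoc]
          _ ≤ ENNReal.ofReal K * Φ p.1 p.2 (2 ^ n * s) + h' p := hle _ _ _
          _ ≤ ENNReal.ofReal K * (K' * Φ p.1 p.2 s + H p) + h' p := by gcongr; exact hH p s
          _ = _ := by rw [mul_add, mul_assoc, add_assoc]
  obtain ⟨n, hn⟩ := pow_unbounded_of_one_lt |r| (one_lt_two : (1 : ℝ) < 2)
  obtain ⟨K', H, hK', hHm, hHi, hHt, hH⟩ := hpow n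
  refine ⟨K', H, hK', hHm, hHi, hHt, fun p s => (hΦ.mono _ _ ?_).trans (hH p s)⟩
  rw [abs_mul, abs_mul, abs_of_pos (by positivity : (0 : ℝ) < 2 ^ n)]
  gcongr

/-- Under the `Δ₂`-condition, `Φ (x, y, ·)` is either finite everywhere or infinite off zero. -/
theorem DeltaTwo.forall_ne_top_or {Φ : X → X → ℝ → ℝ≥0∞} {μ : Measure X}
    (hΔ : DeltaTwo μ Φ) (hΦ : KernelCondition Φ) (x y : X) :
    (∀ s, Φ x y s ≠ ∞) ∨ ∀ s, Φ x y s ≠ ∞ → s = 0 := by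
  by_contra! hcon
  obtain ⟨⟨s, hs⟩, t, ht, ht0⟩ := hcon
  obtain ⟨K, H, hK, -, -, hHt, hH⟩ := hΔ.exists_le_mul_add hΦ (s / t)
  have h := hH (x, y) t
  rw [div_mul_cancel₀ _ ht0, hs] at h
  exact ENNReal.add_ne_top.2 ⟨ENNReal.mul_ne_top hK ht, hHt _⟩ (top_le_iff.1 h)

namespace KernelCondition

variable {Φ : X → X → ℝ → ℝ≥0∞}

theorem convexOn_toReal (hΦ : KernelCondition Φ) {x y : X} (hfin : ∀ s, Φ x y s ≠ ∞) :
    ConvexOn ℝ Set.univ fun s => (Φ x y s).toReal := by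
  refine ⟨convex_univ, fun s _ t _ a b ha hb hab => ?_⟩
  obtain rfl : b = 1 - a := by linarith
  have h := hΦ.convex_comb x y ha (by linarith) s t
  have h1 := ENNReal.mul_ne_top (ENNReal.ofReal_ne_top (r := a)) (hfin s)
  have h2 := ENNReal.mul_ne_top (ENNReal.ofReal_ne_top (r := 1 - a)) (hfin t)
  have h3 := ENNReal.toReal_mono (ENNReal.add_ne_top.2 ⟨h1, h2⟩) h
  rwa [ENNReal.toReal_add h1 h2, ENNReal.toReal_mul, ENNReal.toReal_mul,
    ENNReal.toReal_ofReal ha, ENNReal.toReal_ofReal hb] at h3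

theorem continuous_toReal (hΦ : KernelCondition Φ) {x y : X} (hfin : ∀ s, Φ x y s ≠ ∞) :
    Continuous fun s => (Φ x y s).toReal :=
  continuousOn_univ.1 ((hΦ.convexOn_toReal hfin).continuousOn isOpen_univ)

theorem continuous_of_ne_top (hΦ : KernelCondition Φ) {x y : X} (hfin : ∀ s, Φ x y s ≠ ∞) :
    Continuous (Φ x y) := by
  have h := ENNReal.continuous_ofReal.comp (hΦ.continuous_toReal hfin)
  refine h.congr fun s => ?_
  exact ENNReal.ofReal_toReal (hfin s)

/-- The dual form of a `Δ₂`-inequality for `Φ*`. If `s ↦ t s + c` is an affine minorant of `Φ`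
whose value `a` at `r` is close to `Φ (r)`, then `Φ* (t) ≤ -c`, and testing the bound for
`Φ* (2 t)` at `s = K r / 2` gives `K a ≤ Φ (K r / 2) + h`. -/
theorem le_of_fenchelConj_le (hΦ : KernelCondition Φ) {x y : X} (hfin : ∀ s, Φ x y s ≠ ∞)
    {K h : ℝ} (hK : 0 < K) (hh : 0 ≤ h)
    (hle : ∀ t, fenchelConj Φ x y (2 * t) ≤
      ENNReal.ofReal K * fenchelConj Φ x y t + ENNReal.ofReal h) (r : ℝ) :
    K * (Φ x y r).toReal ≤ (Φ x y (K / 2 * r)).toReal + h := by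
  have hf := hΦ.convexOn_toReal hfin
  have hc := hΦ.continuous_toReal hfin
  suffices hs : ∀ a < (Φ x y r).toReal, K * a ≤ (Φ x y (K / 2 * r)).toReal + h by
    rw [← le_div_iff₀' hK]
    exact le_of_forall_lt_imp_le_of_dense fun a ha => (le_div_iff₀' hK).2 (hs a ha)
  intro a ha
  obtain ⟨t, c, htc, hta⟩ := hf.exists_affine_le_of_lt_real (Set.mem_univ r) ha isClosed_univ
    (hc.lowerSemicontinuous.lowerSemicontinuousOn _)
  have hc0 : c ≤ 0 := by simpa [hΦ.zero] using htc 0 (Set.mem_univ _)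
  have h1 : fenchelConj Φ x y t ≤ ENNReal.ofReal (-c) := by
    refine iSup_le fun s => ?_
    rw [tsub_le_iff_right, ← ENNReal.ofReal_toReal (hfin s),
      ← ENNReal.ofReal_add (by linarith) ENNReal.toReal_nonneg]
    refine ENNReal.ofReal_le_ofReal ?_
    have := htc s (Set.mem_univ _)
    linarith
  have h2 : ENNReal.ofReal (K / 2 * r * (2 * t)) - Φ x y (K / 2 * r) ≤
      ENNReal.ofReal (K * -c + h) := by
    refine (le_iSup (fun s => ENNReal.ofReal (s * (2 * t)) - Φ x y s) (K / 2 * r)).trans ?_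
    refine (hle t).trans ?_
    rw [ENNReal.ofReal_add (by nlinarith) hh, ENNReal.ofReal_mul hK.le]
    gcongr
  rw [tsub_le_iff_right, ← ENNReal.ofReal_toReal (hfin (K / 2 * r)),
    ← ENNReal.ofReal_add (by nlinarith) ENNReal.toReal_nonneg,
    ENNReal.ofReal_le_ofReal_iff (by
      have := ENNReal.toReal_nonneg (a := Φ x y (K / 2 * r))
      nlinarith)] at h2
  rw [← hta]
  linarith

/-- If `Φ` and `Φ*` satisfy the `Δ₂`-condition, then `Φ` satisfies a `∇₂`-condition: for some
`0 < a < 1`, `Φ (2 a s) ≤ a Φ (s)` up to an integrable function. -/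
theorem exists_le_mul_add_of_deltaTwo_fenchelConj (hΦ : KernelCondition Φ) {μ : Measure X}
    (hΔ : DeltaTwo μ Φ) (hΔ' : DeltaTwo μ (fenchelConj Φ)) :
    ∃ (a : ℝ) (H : X × X → ℝ≥0∞), 0 < a ∧ a < 1 ∧ AEMeasurable H (μ.prod μ) ∧
      ∫⁻ p, H p ∂μ.prod μ ≠ ∞ ∧
      ∀ p s, Φ p.1 p.2 (2 * a * s) ≤ ENNReal.ofReal a * Φ p.1 p.2 s + H p := by
  obtain ⟨K₀, h, -, h0, hint, hle⟩ := hΔ'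
  -- the constant may be enlarged, so that `a = 1 / K` is less than one
  obtain ⟨K, hK, hK₀⟩ : ∃ K : ℝ, 1 < K ∧ K₀ ≤ K :=
    ⟨max 2 K₀, lt_max_of_lt_left one_lt_two, le_max_right _ _⟩
  have hK0 : 0 < K := by linarith
  refine ⟨1 / K, fun p => ENNReal.ofReal (h p.1 p.2), by positivity,
    (div_lt_one hK0).2 hK, hint.1.aemeasurable.ennreal_ofReal, ?_, fun p s => ?_⟩
  · rw [← ofReal_integral_eq_lintegral_ofReal hint (Eventually.of_forall fun p => h0 _ _)]
    exact ENNReal.ofReal_ne_top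
  rcases hΔ.forall_ne_top_or hΦ p.1 p.2 with hfin | hinf
  · have key := hΦ.le_of_fenchelConj_le hfin hK0 (h0 p.1 p.2) (fun t =>
      (hle p.1 p.2 t).trans (by gcongr)) (2 * (1 / K) * s)
    rw [show K / 2 * (2 * (1 / K) * s) = s by field_simp] at key
    rw [← ENNReal.ofReal_toReal (hfin (2 * (1 / K) * s)), ← ENNReal.ofReal_toReal (hfin s),
      ← ENNReal.ofReal_mul (by positivity), ← ENNReal.ofReal_add (by positivity) (h0 _ _)]
    refine ENNReal.ofReal_le_ofReal ?_
    have hp := h0 p.1 p.2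
    have h1 : (Φ p.1 p.2 (2 * (1 / K) * s)).toReal ≤
        1 / K * ((Φ p.1 p.2 s).toReal + h p.1 p.2) := by
      rw [one_div_mul_eq_div, le_div_iff₀' hK0]
      exact key
    have h2 : 1 / K * h p.1 p.2 ≤ h p.1 p.2 :=
      mul_le_of_le_one_left hp ((div_le_one hK0).2 hK.le)
    linarith
  · by_cases hs : Φ p.1 p.2 s = ∞
    · have : ENNReal.ofReal (1 / K) ≠ 0 := by
        rw [Ne, ENNReal.ofReal_eq_zero, not_le]; positivity
      rw [hs, ENNReal.mul_top this, top_add]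
      exact le_top
    · rw [hinf s hs, mul_zero, hΦ.zero]
      exact zero_le

/-- There is an integrable weight `w`, positive on the active set, against which `|s|` is dominated
by `Φ (x, y, s)` up to an integrable function. -/
theorem exists_weight (hΦ : KernelCondition Φ) (μ : Measure X) [SigmaFinite μ] :
    ∃ w g : X × X → ℝ≥0∞, Measurable w ∧ Measurable g ∧ ∫⁻ p, w p ∂μ.prod μ ≠ ∞ ∧
      ∫⁻ p, g p ∂μ.prod μ ≠ ∞ ∧
      (∀ p ∈ activeSet Φ, w p ≠ 0) ∧
      ∀ p s, w p * ENNReal.ofReal |s| ≤ Φ p.1 p.2 s + g p := by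
  obtain ⟨g, hg0, hgm, hgi⟩ := exists_pos_lintegral_lt_of_sigmaFinite (μ.prod μ) one_ne_zero
  set g' : X × X → ℝ≥0∞ := fun p => min (g p : ℝ≥0∞) 1 with hg'
  have hg'm : Measurable g' := (hgm.coe_nnreal_ennreal).min measurable_const
  have hg'i : ∫⁻ p, g' p ∂μ.prod μ ≠ ∞ :=
    ne_top_of_le_ne_top hgi.ne_top (lintegral_mono fun p => min_le_left _ _)
  -- a measurable choice of a slope `c` with `c |s| ≤ Φ (s) + 1`, positive since `Φ` grows at least
  -- linearly on the active set
  let c : X × X → ℝ≥0∞ := fun p => ⨅ n : ℕ, (Φ p.1 p.2 n + 1) / ((n : ℝ≥0∞) + 1)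
  have hcm : Measurable c := Measurable.iInf fun n =>
    ((hΦ.measurable n).add_const 1).div_const _
  have hc : ∀ p s, c p * ENNReal.ofReal |s| ≤ Φ p.1 p.2 s + 1 := by
    intro p s
    set n := ⌊|s|⌋₊ with hn
    have h1 : (n : ℝ) ≤ |s| := Nat.floor_le (abs_nonneg s)
    have h2 : |s| ≤ n + 1 := (Nat.lt_floor_add_one |s|).le
    calc c p * ENNReal.ofReal |s|
        ≤ (Φ p.1 p.2 n + 1) / ((n : ℝ≥0∞) + 1) * ((n : ℝ≥0∞) + 1) := by
          gcongr
          · exact iInf_le _ n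
          · refine (ENNReal.ofReal_le_ofReal h2).trans_eq ?_
            rw [ENNReal.ofReal_add (by positivity) zero_le_one]
            simp
      _ = Φ p.1 p.2 n + 1 := ENNReal.div_mul_cancel (by simp) (by simp)
      _ ≤ Φ p.1 p.2 s + 1 := by
          gcongr
          refine hΦ.mono _ _ ?_
          rwa [abs_of_nonneg (by positivity : (0 : ℝ) ≤ n)]
  have hcpos : ∀ p ∈ activeSet Φ, c p ≠ 0 := by
    intro p hp
    obtain ⟨s, hs⟩ : ∃ s, Φ p.1 p.2 s ≠ 0 := by simpa [activeSet] using hp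
    obtain ⟨N, hN⟩ := exists_nat_ge |s|
    have hN0 : N ≠ 0 := by
      rintro rfl
      have : s = 0 := by simpa using hN
      exact hs (by rw [this, hΦ.zero])
    have hNr : (0 : ℝ) < N := by exact_mod_cast Nat.pos_of_ne_zero hN0
    set q := min (Φ p.1 p.2 N) 1 with hq
    have hq0 : q ≠ 0 := by
      refine (lt_min (pos_iff_ne_zero.2 fun h => hs ?_) zero_lt_one).ne'
      rw [← nonpos_iff_eq_zero, ← h]
      exact hΦ.mono _ _ (by rwa [abs_of_pos hNr])
    have hlow : q / N ≤ c p := by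
      refine le_iInf fun n => ?_
      rw [ENNReal.le_div_iff_mul_le (by simp) (by simp), mul_comm, ← mul_div_assoc,
        ENNReal.div_le_iff (by simpa using hN0) (by simp)]
      have hN1 : (1 : ℝ≥0∞) ≤ N := by exact_mod_cast Nat.one_le_iff_ne_zero.2 hN0
      -- for `N ≤ n`, convexity gives `n Φ (N) ≤ N Φ (n)`
      rcases lt_or_ge n N with hn | hn
      · calc ((n : ℝ≥0∞) + 1) * q ≤ N * 1 := by
              gcongr
              · exact_mod_cast hn
              · exact min_le_right _ _
          _ = 1 * N := by ring
          _ ≤ (Φ p.1 p.2 n + 1) * N := by gcongr; exact le_add_self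
      · have hnr : (N : ℝ) ≤ n := by exact_mod_cast hn
        have hn0 : (0 : ℝ) < n := hNr.trans_le hnr
        have h1 := hΦ.smul_le p.1 p.2 (a := N / n) (by positivity) ((div_le_one hn0).2 hnr) n
        rw [div_mul_cancel₀ _ hn0.ne'] at h1
        have h2 : (n : ℝ≥0∞) * ENNReal.ofReal (N / n) = N := by
          rw [← ENNReal.ofReal_natCast n, ← ENNReal.ofReal_mul hn0.le, mul_div_cancel₀ _ hn0.ne',
            ENNReal.ofReal_natCast]
        calc ((n : ℝ≥0∞) + 1) * q = n * q + q := by ring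
          _ ≤ n * (ENNReal.ofReal (N / n) * Φ p.1 p.2 n) + N := by
              gcongr
              · exact (min_le_left _ _).trans h1
              · exact (min_le_right _ _).trans hN1
          _ = (Φ p.1 p.2 n + 1) * N := by rw [← mul_assoc, h2]; ring
    exact ne_of_gt (lt_of_lt_of_le (ENNReal.div_pos hq0 (by simp)) hlow)
  refine ⟨fun p => g' p * min 1 (c p), g', hg'm.mul (measurable_const.min hcm), hg'm,
    ne_top_of_le_ne_top hg'i (lintegral_mono fun p => mul_le_of_le_one_right' (min_le_left _ _)),
    hg'i, fun p hp => ?_, fun p s => ?_⟩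
  · refine mul_ne_zero (lt_min ?_ zero_lt_one).ne' (lt_min zero_lt_one ?_).ne'
    · exact_mod_cast hg0 p
    · exact pos_iff_ne_zero.2 (hcpos p hp)
  · calc g' p * min 1 (c p) * ENNReal.ofReal |s|
        ≤ g' p * (c p * ENNReal.ofReal |s|) := by
          rw [mul_assoc]; gcongr; exact min_le_right _ _
      _ ≤ g' p * (Φ p.1 p.2 s + 1) := by gcongr; exact hc p s
      _ = g' p * Φ p.1 p.2 s + g' p := by rw [mul_add, mul_one]
      _ ≤ Φ p.1 p.2 s + g' p := by
          gcongr
          exact mul_le_of_le_one_left' (min_le_right _ _)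

end KernelCondition

/-! ### Quantitative convexity -/

theorem sqrt_one_add_sq_le (s : ℝ) : √(1 + s ^ 2) ≤ 1 + |s| := by
  rw [Real.sqrt_le_left (by positivity)]
  nlinarith [abs_nonneg s, sq_abs s]

/-- Midpoint convexity of `√(1 + s²)`, quantified: this is the strict triangle inequality for the
vectors `(1, a)` and `(1, b)` of the plane. -/
theorem sq_sub_le_sqrt_gap (a b : ℝ) :
    (a - b) ^ 2 ≤ (√(1 + a ^ 2) + √(1 + b ^ 2) - 2 * √(1 + ((a + b) / 2) ^ 2)) *
      (√(1 + a ^ 2) + √(1 + b ^ 2)) ^ 3 := by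
  set A := √(1 + a ^ 2) with hA
  set B := √(1 + b ^ 2) with hB
  set D := √(1 + ((a + b) / 2) ^ 2) with hD
  have hA2 : A ^ 2 = 1 + a ^ 2 := Real.sq_sqrt (by positivity)
  have hB2 : B ^ 2 = 1 + b ^ 2 := Real.sq_sqrt (by positivity)
  have hD2 : D ^ 2 = 1 + ((a + b) / 2) ^ 2 := Real.sq_sqrt (by positivity)
  have hA0 : 0 < A := Real.sqrt_pos.2 (by positivity)
  have hB0 : 0 < B := Real.sqrt_pos.2 (by positivity)
  have hD0 : 0 < D := Real.sqrt_pos.2 (by positivity)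
  have hprod : (A * B - (1 + a * b)) * (A * B + (1 + a * b)) = (a - b) ^ 2 := by
    have : (A * B) ^ 2 = (1 + a ^ 2) * (1 + b ^ 2) := by rw [mul_pow, hA2, hB2]
    linear_combination this
  have hle : |1 + a * b| ≤ A * B := by
    refine abs_le_of_sq_le_sq ?_ (by positivity)
    rw [mul_pow, hA2, hB2]
    nlinarith [sq_nonneg (a - b)]
  obtain ⟨hle1, hle2⟩ := abs_le.1 hle
  have hgap : (A + B - 2 * D) * (A + B + 2 * D) = 2 * (A * B - (1 + a * b)) := by
    linear_combination hA2 + hB2 - 4 * hD2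
  have hg0 : 0 ≤ A + B - 2 * D := by
    have : 0 ≤ (A + B - 2 * D) * (A + B + 2 * D) := by rw [hgap]; linarith
    exact nonneg_of_mul_nonneg_left this (by positivity)
  have hABsq : A * B + (1 + a * b) ≤ (A + B) ^ 2 / 2 := by nlinarith [sq_nonneg (A - B)]
  calc (a - b) ^ 2 = (A + B - 2 * D) * ((A + B + 2 * D) / 2 * (A * B + (1 + a * b))) := by
        rw [← hprod]; linear_combination (-(A * B + (1 + a * b)) / 2) * hgap
    _ ≤ (A + B - 2 * D) * ((A + B + (A + B)) / 2 * ((A + B) ^ 2 / 2)) := by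
        have h1 : 2 * D ≤ A + B := by linarith
        have h2 : 0 ≤ A * B + (1 + a * b) := by linarith
        gcongr
    _ ≤ (A + B - 2 * D) * (A + B) ^ 3 := by
        gcongr
        nlinarith [pow_pos (add_pos hA0 hB0) 3]

/-- A splitting of `sq_sub_le_sqrt_gap` into the gap and a small multiple of the size, which can be
integrated termwise although `√(1 + s²)` is not uniformly convex. -/
theorem sqrt_abs_sub_le (a b : ℝ) {τ : ℝ} (hτ : 0 < τ) :
    √|a - b| ≤ 1 / τ ^ 3 * (√(1 + a ^ 2) + √(1 + b ^ 2) - 2 * √(1 + ((a + b) / 2) ^ 2)) +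
      τ * (√(1 + a ^ 2) + √(1 + b ^ 2)) := by
  have key := sq_sub_le_sqrt_gap a b
  set S := √(1 + a ^ 2) + √(1 + b ^ 2) with hS
  set g := S - 2 * √(1 + ((a + b) / 2) ^ 2) with hg
  have hS0 : 0 < S := by positivity
  have hg0 : 0 ≤ g := by
    have : 0 ≤ g * S ^ 3 := (sq_nonneg _).trans key
    exact nonneg_of_mul_nonneg_left this (by positivity)
  set y := √|a - b| with hy
  have hy0 : 0 ≤ y := Real.sqrt_nonneg _
  have hy4 : y ^ 4 = (a - b) ^ 2 := by
    rw [show y ^ 4 = (y ^ 2) ^ 2 by ring, hy, Real.sq_sqrt (abs_nonneg _), sq_abs]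
  rcases le_total y (τ * S) with h | h
  · have : 0 ≤ 1 / τ ^ 3 * g := by positivity
    linarith
  · have hypos : 0 < y := lt_of_lt_of_le (by positivity) h
    have h1 : y * y ^ 3 ≤ 1 / τ ^ 3 * g * y ^ 3 := by
      calc y * y ^ 3 = (a - b) ^ 2 := by rw [← hy4]; ring
        _ ≤ g * S ^ 3 := key
        _ = 1 / τ ^ 3 * g * (τ * S) ^ 3 := by field_simp
        _ ≤ 1 / τ ^ 3 * g * y ^ 3 := by gcongr
    have := le_of_mul_le_mul_right h1 (by positivity)
    have : 0 ≤ τ * S := by positivity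
    linarith

/-- Dominated convergence to zero, where the dominating function may vary by terms that tend to
zero in `L¹`. -/
theorem tendsto_lintegral_zero_of_le_mul_add {α : Type*} [MeasurableSpace α] {ν : Measure α}
    {f g : ℕ → α → ℝ≥0∞} {H : α → ℝ≥0∞} {K : ℝ≥0∞} (hf : ∀ k, AEMeasurable (f k) ν)
    (hH : AEMeasurable H ν) (hHi : ∫⁻ a, H a ∂ν ≠ ∞) (hK : K ≠ ∞)
    (hle : ∀ k, ∀ᵐ a ∂ν, f k a ≤ K * g k a + H a)
    (hg : Tendsto (fun k => ∫⁻ a, g k a ∂ν) atTop (𝓝 0))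
    (hf0 : ∀ᵐ a ∂ν, Tendsto (fun k => f k a) atTop (𝓝 0)) :
    Tendsto (fun k => ∫⁻ a, f k a ∂ν) atTop (𝓝 0) := by
  have h1 : Tendsto (fun k => ∫⁻ a, min (f k a) (H a) ∂ν) atTop (𝓝 0) := by
    have := tendsto_lintegral_of_dominated_convergence' (μ := ν) (f := fun _ => 0) H
      (fun k => (hf k).min hH) (fun k => Eventually.of_forall fun a => min_le_right _ _) hHi
      (by
        filter_upwards [hf0] with a ha
        exact tendsto_of_tendsto_of_tendsto_of_le_of_le tendsto_const_nhds ha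
          (fun _ => zero_le) (fun k => min_le_left _ _))
    simpa using this
  have h2 : Tendsto (fun k => K * ∫⁻ a, g k a ∂ν) atTop (𝓝 0) := by
    simpa using ENNReal.Tendsto.const_mul hg (.inr hK)
  refine tendsto_of_tendsto_of_tendsto_of_le_of_le tendsto_const_nhds
    (by simpa using h1.add h2) (fun _ => zero_le) fun k => ?_
  dsimp only
  rw [← lintegral_const_mul' _ _ hK, ← lintegral_add_left' ((hf k).min hH)]
  refine lintegral_mono_ae ?_
  filter_upwards [hle k] with a ha
  rcases le_total (f k a) (H a) with h | h
  · rw [min_eq_left h]; exact le_self_add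
  · rw [min_eq_right h, add_comm]; exact ha

namespace KernelCondition

variable {Φ : X → X → ℝ → ℝ≥0∞}

/-- Where `Φ (2 a s) ≤ a Φ (s) + h`, the convexity gap of `Φ` between `s` and `t` with weights `a`
and `1 - a` controls `Φ (s)` in terms of `t`: the point `a s + (1 - a) t` is the midpoint of
`2 a s` and `2 (1 - a) t`. -/
theorem mul_le_gap_add (hΦ : KernelCondition Φ) {x y : X} {a : ℝ} (ha : 0 ≤ a) (ha1 : a ≤ 1)
    {s : ℝ} (t : ℝ) {h : ℝ≥0∞} (hs : Φ x y s ≠ ∞)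
    (hle : Φ x y (2 * a * s) ≤ ENNReal.ofReal a * Φ x y s + h) :
    ENNReal.ofReal a * Φ x y s ≤
      2 * (ENNReal.ofReal a * Φ x y s + ENNReal.ofReal (1 - a) * Φ x y t -
        Φ x y (a * s + (1 - a) * t)) + (h + Φ x y (2 * t)) := by
  set A := ENNReal.ofReal a * Φ x y s with hA
  set G := A + ENNReal.ofReal (1 - a) * Φ x y t - Φ x y (a * s + (1 - a) * t) with hG
  have hAt : A ≠ ∞ := ENNReal.mul_ne_top ENNReal.ofReal_ne_top hs
  have hmix : Φ x y (a * s + (1 - a) * t) ≤ 2⁻¹ * (A + h) + 2⁻¹ * Φ x y (2 * t) := by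
    have h1 := hΦ.convex_comb x y (a := 1 / 2) (by norm_num) (by norm_num) (2 * a * s)
      (2 * (1 - a) * t)
    have h2 : Φ x y (2 * (1 - a) * t) ≤ Φ x y (2 * t) := by
      refine hΦ.mono _ _ ?_
      rw [abs_mul, abs_mul 2 t, abs_of_nonneg (by linarith : 0 ≤ 2 * (1 - a)), abs_two]
      gcongr
      linarith
    rw [show (1 / 2 : ℝ) * (2 * a * s) + (1 - 1 / 2) * (2 * (1 - a) * t)
      = a * s + (1 - a) * t by ring, show (1 - 1 / 2 : ℝ) = 2⁻¹ by norm_num,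
      show (1 / 2 : ℝ) = 2⁻¹ by norm_num, ENNReal.ofReal_inv_of_pos two_pos,
      ENNReal.ofReal_ofNat] at h1
    refine h1.trans ?_
    gcongr
  have hle1 : A ≤ G + Φ x y (a * s + (1 - a) * t) := by
    rw [hG, tsub_add_cancel_of_le (hΦ.convex_comb x y ha ha1 s t)]
    exact le_self_add
  refine ENNReal.le_of_add_le_add_left hAt ?_
  calc A + A = 2 * A := (two_mul A).symm
    _ ≤ 2 * (G + (2⁻¹ * (A + h) + 2⁻¹ * Φ x y (2 * t))) := by
        gcongr
        exact hle1.trans (by gcongr)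
    _ = A + (2 * G + (h + Φ x y (2 * t))) := by
        rw [mul_add, mul_add 2 (2⁻¹ * (A + h)), ← mul_assoc, ← mul_assoc,
          ENNReal.mul_inv_cancel two_ne_zero ENNReal.ofNat_ne_top, one_mul, one_mul]
        ring

/-- Lower semicontinuity of the convexity gap. It uses that `Φ (x, y, ·)` is continuous if it is
finite everywhere, since the gap contains `-Φ`. -/
theorem gap_le_liminf (hΦ : KernelCondition Φ) {μ : Measure X} (hΔ : DeltaTwo μ Φ) {x y : X}
    {a s t : ℝ} {b : ℕ → ℝ} (hs : Φ x y s ≠ ∞) (hb : ∀ m, Φ x y (b m) ≠ ∞)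
    (hbt : Tendsto b atTop (𝓝 t)) :
    ENNReal.ofReal a * Φ x y s + ENNReal.ofReal (1 - a) * Φ x y t - Φ x y (a * s + (1 - a) * t) ≤
      liminf (fun m => ENNReal.ofReal a * Φ x y s + ENNReal.ofReal (1 - a) * Φ x y (b m) -
        Φ x y (a * s + (1 - a) * b m)) atTop := by
  rcases hΔ.forall_ne_top_or hΦ x y with hfin | hinf
  · have hc := hΦ.continuous_of_ne_top hfin
    refine (Tendsto.liminf_eq ?_).ge
    refine ENNReal.Tendsto.sub (tendsto_const_nhds.add
      (ENNReal.Tendsto.const_mul ((hc.tendsto t).comp hbt) (.inr ENNReal.ofReal_ne_top)))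
      ((hc.tendsto _).comp (tendsto_const_nhds.add (hbt.const_mul _))) (.inr (hfin _))
  · have ht : t = 0 := by
      refine tendsto_nhds_unique hbt ?_
      rw [show b = fun _ => 0 from funext fun m => hinf _ (hb m)]
      exact tendsto_const_nhds
    rw [ht, hinf s hs]
    simp [hΦ.zero]

/-- If the terms of an almost everywhere convergent sequence have small convexity gaps among each
other, then the sequence converges in the modular, at every scale `r`. -/
theorem tendsto_lintegral_of_gap (hΦ : KernelCondition Φ) {μ : Measure X} [SigmaFinite μ]
    (hΔ : DeltaTwo μ Φ) {a : ℝ} (ha0 : 0 < a) (ha1 : a < 1) {H : X × X → ℝ≥0∞}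
    (hHm : AEMeasurable H (μ.prod μ)) (hHi : ∫⁻ p, H p ∂μ.prod μ ≠ ∞)
    (hH : ∀ p s, Φ p.1 p.2 (2 * a * s) ≤ ENNReal.ofReal a * Φ p.1 p.2 s + H p)
    {A : ℕ → X × X → ℝ} {c : X × X → ℝ} (hA : ∀ k, Measurable (A k)) (hc : Measurable c)
    (hAc : ∀ᵐ p ∂μ.prod μ, Tendsto (fun k => A k p) atTop (𝓝 (c p)))
    (hAi : ∀ k, ∫⁻ p, Φ p.1 p.2 (A k p) ∂μ.prod μ ≠ ∞)
    (hci : ∫⁻ p, Φ p.1 p.2 (c p) ∂μ.prod μ ≠ ∞) {δ : ℕ → ℝ≥0∞} (hδ : Tendsto δ atTop (𝓝 0))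
    (hgap : ∀ k m, k ≤ m → ENNReal.ofReal a * ∫⁻ p, Φ p.1 p.2 (A k p) ∂μ.prod μ +
      ENNReal.ofReal (1 - a) * ∫⁻ p, Φ p.1 p.2 (A m p) ∂μ.prod μ ≤
      ∫⁻ p, Φ p.1 p.2 (a * A k p + (1 - a) * A m p) ∂μ.prod μ + δ k) (r : ℝ) :
    Tendsto (fun k => ∫⁻ p, Φ p.1 p.2 ((A k p - c p) / r) ∂μ.prod μ) atTop (𝓝 0) := by
  have hAm : ∀ k, Measurable fun p : X × X => Φ p.1 p.2 (A k p) := fun k =>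
    hΦ.measurable_comp (hA k)
  have hcm : Measurable fun p : X × X => Φ p.1 p.2 (c p) := hΦ.measurable_comp hc
  have hmixm : ∀ k m, Measurable fun p : X × X => Φ p.1 p.2 (a * A k p + (1 - a) * A m p) :=
    fun k m => hΦ.measurable_comp (((hA k).const_mul _).add ((hA m).const_mul _))
  have hfinA : ∀ᵐ p ∂μ.prod μ, ∀ k, Φ p.1 p.2 (A k p) ≠ ∞ := ae_all_iff.2 fun k => by
    filter_upwards [ae_lt_top (hAm k) (hAi k)] with p hp using hp.ne
  -- the gap between two terms of the sequence has small integral, and by Fatou's lemma so has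
  -- the gap between a term and the limit
  have hgapint : ∀ k m, k ≤ m → ∫⁻ p, (ENNReal.ofReal a * Φ p.1 p.2 (A k p) +
      ENNReal.ofReal (1 - a) * Φ p.1 p.2 (A m p) -
        Φ p.1 p.2 (a * A k p + (1 - a) * A m p)) ∂μ.prod μ ≤ δ k := by
    intro k m hkm
    have hsum : ∫⁻ p, (ENNReal.ofReal a * Φ p.1 p.2 (A k p) +
        ENNReal.ofReal (1 - a) * Φ p.1 p.2 (A m p)) ∂μ.prod μ =
        ENNReal.ofReal a * ∫⁻ p, Φ p.1 p.2 (A k p) ∂μ.prod μ +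
        ENNReal.ofReal (1 - a) * ∫⁻ p, Φ p.1 p.2 (A m p) ∂μ.prod μ := by
      rw [lintegral_add_left ((hAm k).const_mul _), lintegral_const_mul _ (hAm k),
        lintegral_const_mul _ (hAm m)]
    have hle : ∀ p : X × X, Φ p.1 p.2 (a * A k p + (1 - a) * A m p) ≤
        ENNReal.ofReal a * Φ p.1 p.2 (A k p) + ENNReal.ofReal (1 - a) * Φ p.1 p.2 (A m p) :=
      fun p => hΦ.convex_comb _ _ ha0.le ha1.le _ _
    rw [lintegral_sub (hmixm k m) _ (Eventually.of_forall hle), hsum, tsub_le_iff_left]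
    · exact hgap k m hkm
    · refine ne_top_of_le_ne_top ?_ (lintegral_mono hle)
      rw [hsum]
      exact ENNReal.add_ne_top.2 ⟨ENNReal.mul_ne_top ENNReal.ofReal_ne_top (hAi k),
        ENNReal.mul_ne_top ENNReal.ofReal_ne_top (hAi m)⟩
  set G : ℕ → X × X → ℝ≥0∞ := fun k p => ENNReal.ofReal a * Φ p.1 p.2 (A k p) +
    ENNReal.ofReal (1 - a) * Φ p.1 p.2 (c p) - Φ p.1 p.2 (a * A k p + (1 - a) * c p) with hG
  have hGint : ∀ k, ∫⁻ p, G k p ∂μ.prod μ ≤ δ k := by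
    intro k
    have h1 : ∫⁻ p, G k p ∂μ.prod μ ≤ ∫⁻ p, liminf (fun m => ENNReal.ofReal a *
        Φ p.1 p.2 (A k p) + ENNReal.ofReal (1 - a) * Φ p.1 p.2 (A m p) -
        Φ p.1 p.2 (a * A k p + (1 - a) * A m p)) atTop ∂μ.prod μ := by
      refine lintegral_mono_ae ?_
      filter_upwards [hAc, hfinA] with p hp hfin
      exact hΦ.gap_le_liminf hΔ (hfin k) hfin hp
    refine h1.trans ((lintegral_liminf_le fun m => (((hAm k).const_mul _).add
      ((hAm m).const_mul _)).sub (hmixm k m)).trans ?_)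
    refine liminf_le_of_le (by isBoundedDefault) fun b hb => ?_
    obtain ⟨m, hm, hkm⟩ := (hb.and (eventually_ge_atTop k)).exists
    exact hm.trans (hgapint k m hkm)
  have hG0 : Tendsto (fun k => ∫⁻ p, G k p ∂μ.prod μ) atTop (𝓝 0) :=
    tendsto_of_tendsto_of_tendsto_of_le_of_le tendsto_const_nhds hδ (fun _ => zero_le) hGint
  obtain ⟨K₁, H₁, hK₁, hH₁m, hH₁i, -, hH₁⟩ := hΔ.exists_le_mul_add hΦ (2 / r)
  have hci2 : ∫⁻ p, Φ p.1 p.2 (2 * c p) ∂μ.prod μ ≠ ∞ := by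
    obtain ⟨K₂, H₂, hK₂, hH₂m, hH₂i, -, hH₂⟩ := hΔ.exists_le_mul_add hΦ 2
    refine ne_top_of_le_ne_top ?_ (lintegral_mono fun p => hH₂ p (c p))
    rw [lintegral_add_left (hcm.const_mul _), lintegral_const_mul _ hcm]
    exact ENNReal.add_ne_top.2 ⟨ENNReal.mul_ne_top hK₂ hci, hH₂i⟩
  set L : ℝ≥0∞ := (ENNReal.ofReal a)⁻¹ with hL
  have ha' : ENNReal.ofReal a ≠ 0 := by simpa using ha0
  have hLt : L ≠ ∞ := ENNReal.inv_ne_top.2 ha'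
  have hm₂ : AEMeasurable (fun p : X × X => K₁ * Φ p.1 p.2 (c p) + H₁ p) (μ.prod μ) :=
    (hcm.aemeasurable.const_mul K₁).add hH₁m
  -- a dominating function, up to a multiple of the gap
  refine tendsto_lintegral_zero_of_le_mul_add (g := G) (K := K₁ * (L * 2))
    (H := fun p => K₁ * (L * (H p + Φ p.1 p.2 (2 * c p))) + H₁ p +
      (K₁ * Φ p.1 p.2 (c p) + H₁ p))
    (fun k => (hΦ.measurable_comp (((hA k).sub hc).div_const r)).aemeasurable) ?_ ?_
    (ENNReal.mul_ne_top hK₁ (ENNReal.mul_ne_top hLt ENNReal.ofNat_ne_top)) ?_ hG0 ?_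
  · exact ((((hHm.add (hΦ.measurable_comp (hc.const_mul 2)).aemeasurable).const_mul
      L).const_mul K₁).add hH₁m).add hm₂
  · rw [lintegral_add_right' _ hm₂,
      lintegral_add_right' _ hH₁m, lintegral_const_mul' _ _ hK₁, lintegral_const_mul' _ _ hLt,
      lintegral_add_left' hHm, lintegral_add_right' _ hH₁m, lintegral_const_mul' _ _ hK₁]
    exact ENNReal.add_ne_top.2 ⟨ENNReal.add_ne_top.2 ⟨ENNReal.mul_ne_top hK₁
      (ENNReal.mul_ne_top hLt (ENNReal.add_ne_top.2 ⟨hHi, hci2⟩)), hH₁i⟩,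
      ENNReal.add_ne_top.2 ⟨ENNReal.mul_ne_top hK₁ hci, hH₁i⟩⟩
  · intro k
    filter_upwards [hfinA] with p hfin
    have h1 : Φ p.1 p.2 ((A k p - c p) / r) ≤
        Φ p.1 p.2 (2 / r * A k p) + Φ p.1 p.2 (2 / r * c p) := by
      have h := hΦ.convex_comb p.1 p.2 (a := 1 / 2) (by norm_num) (by norm_num)
        (2 / r * A k p) (-(2 / r * c p))
      rw [hΦ.even, show (1 / 2 : ℝ) * (2 / r * A k p) + (1 - 1 / 2) * -(2 / r * c p)
        = (A k p - c p) / r by ring] at h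
      refine h.trans (add_le_add (mul_le_of_le_one_left' ?_) (mul_le_of_le_one_left' ?_))
      · rw [ENNReal.ofReal_le_one]; norm_num
      · rw [ENNReal.ofReal_le_one]; norm_num
    have h2 : Φ p.1 p.2 (A k p) ≤ L * (2 * G k p + (H p + Φ p.1 p.2 (2 * c p))) := by
      have h := hΦ.mul_le_gap_add ha0.le ha1.le (c p) (hfin k) (hH p (A k p))
      calc Φ p.1 p.2 (A k p) = L * (ENNReal.ofReal a * Φ p.1 p.2 (A k p)) := by
            rw [← mul_assoc, hL, ENNReal.inv_mul_cancel ha' ENNReal.ofReal_ne_top, one_mul]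
        _ ≤ _ := by gcongr
    calc Φ p.1 p.2 ((A k p - c p) / r)
        ≤ (K₁ * Φ p.1 p.2 (A k p) + H₁ p) + (K₁ * Φ p.1 p.2 (c p) + H₁ p) :=
          h1.trans (add_le_add (hH₁ _ _) (hH₁ _ _))
      _ ≤ (K₁ * (L * (2 * G k p + (H p + Φ p.1 p.2 (2 * c p)))) + H₁ p) +
          (K₁ * Φ p.1 p.2 (c p) + H₁ p) := by gcongr
      _ = _ := by ring
  · filter_upwards [hAc, hfinA] with p hp hfin
    have h0 : Tendsto (fun k => (A k p - c p) / r) atTop (𝓝 0) := by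
      simpa using (hp.sub_const (c p)).div_const r
    rcases hΔ.forall_ne_top_or hΦ p.1 p.2 with hf | hinf
    · have := ((hΦ.continuous_of_ne_top hf).tendsto 0).comp h0
      rwa [hΦ.zero] at this
    · have hA0 : ∀ k, A k p = 0 := fun k => hinf _ (hfin k)
      have hc0 : c p = 0 := by
        refine tendsto_nhds_unique hp ?_
        simp [hA0]
      simp [hA0, hc0, hΦ.zero]

end KernelCondition

/-- The parallelogram identity, for a small midpoint gap of `∫ f²`. -/
theorem lintegral_sq_sub_le {α : Type*} [MeasurableSpace α] {ν : Measure α} {f g : α → ℝ}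
    (hf : Measurable f) (hg : Measurable g) {δ : ℝ≥0∞}
    (hfin : ∫⁻ x, ENNReal.ofReal ((1 / 2 * f x + (1 - 1 / 2) * g x) ^ 2) ∂ν ≠ ∞)
    (h : ENNReal.ofReal (1 / 2) * ∫⁻ x, ENNReal.ofReal (f x ^ 2) ∂ν +
      ENNReal.ofReal (1 - 1 / 2) * ∫⁻ x, ENNReal.ofReal (g x ^ 2) ∂ν ≤
      ∫⁻ x, ENNReal.ofReal ((1 / 2 * f x + (1 - 1 / 2) * g x) ^ 2) ∂ν + δ) :
    ∫⁻ x, ENNReal.ofReal ((f x - g x) ^ 2) ∂ν ≤ 4 * δ := by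
  have hpt : ∀ x, ENNReal.ofReal (1 / 2) * ENNReal.ofReal (f x ^ 2) +
      ENNReal.ofReal (1 - 1 / 2) * ENNReal.ofReal (g x ^ 2) =
      ENNReal.ofReal ((1 / 2 * f x + (1 - 1 / 2) * g x) ^ 2) +
      ENNReal.ofReal (1 / 4) * ENNReal.ofReal ((f x - g x) ^ 2) := by
    intro x
    rw [← ENNReal.ofReal_mul (by norm_num), ← ENNReal.ofReal_mul (by norm_num),
      ← ENNReal.ofReal_mul (by norm_num), ← ENNReal.ofReal_add (by positivity)
      (mul_nonneg (by norm_num) (sq_nonneg _)), ← ENNReal.ofReal_add (by positivity)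
      (by positivity)]
    congr 1
    ring
  rw [← lintegral_const_mul _ (by fun_prop), ← lintegral_const_mul _ (by fun_prop),
    ← lintegral_add_left (by fun_prop), lintegral_congr hpt, lintegral_add_left (by fun_prop),
    lintegral_const_mul _ (by fun_prop)] at h
  have h1 := ENNReal.le_of_add_le_add_left hfin h
  calc ∫⁻ x, ENNReal.ofReal ((f x - g x) ^ 2) ∂ν
      = 4 * (ENNReal.ofReal (1 / 4) * ∫⁻ x, ENNReal.ofReal ((f x - g x) ^ 2) ∂ν) := by
        rw [← mul_assoc, ← ENNReal.ofReal_ofNat 4, ← ENNReal.ofReal_mul (by norm_num)]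
        norm_num
    _ ≤ 4 * δ := by gcongr

theorem lintegral_sqrt_sub_le {α : Type*} [MeasurableSpace α] {ν : Measure α} {f g : α → ℝ}
    {w : α → ℝ≥0∞} (hw : Measurable w) (hf : Measurable f) (hg : Measurable g) {δ : ℝ≥0∞}
    (hfin : ∫⁻ x, w x * ENNReal.ofReal √(1 + (1 / 2 * f x + (1 - 1 / 2) * g x) ^ 2) ∂ν ≠ ∞)
    (h : ENNReal.ofReal (1 / 2) * ∫⁻ x, w x * ENNReal.ofReal √(1 + f x ^ 2) ∂ν +
      ENNReal.ofReal (1 - 1 / 2) * ∫⁻ x, w x * ENNReal.ofReal √(1 + g x ^ 2) ∂ν ≤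
      ∫⁻ x, w x * ENNReal.ofReal √(1 + (1 / 2 * f x + (1 - 1 / 2) * g x) ^ 2) ∂ν + δ)
    {τ : ℝ} (hτ : 0 < τ) :
    ∫⁻ x, w x * ENNReal.ofReal √|f x - g x| ∂ν ≤ ENNReal.ofReal (2 / τ ^ 3) * δ +
      ENNReal.ofReal τ * (∫⁻ x, w x * ENNReal.ofReal √(1 + f x ^ 2) ∂ν +
        ∫⁻ x, w x * ENNReal.ofReal √(1 + g x ^ 2) ∂ν) := by
  have hgap0 : ∀ x, 0 ≤ √(1 + f x ^ 2) + √(1 + g x ^ 2) - 2 * √(1 + ((f x + g x) / 2) ^ 2) := by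
    intro x
    have h1 := (sq_nonneg _).trans (sq_sub_le_sqrt_gap (f x) (g x))
    exact nonneg_of_mul_nonneg_left h1 (by positivity)
  set G : α → ℝ≥0∞ := fun x => w x * ENNReal.ofReal
    ((√(1 + f x ^ 2) + √(1 + g x ^ 2) - 2 * √(1 + ((f x + g x) / 2) ^ 2)) / 2) with hG
  have hpt : ∀ x, ENNReal.ofReal (1 / 2) * (w x * ENNReal.ofReal √(1 + f x ^ 2)) +
      ENNReal.ofReal (1 - 1 / 2) * (w x * ENNReal.ofReal √(1 + g x ^ 2)) =
      w x * ENNReal.ofReal √(1 + (1 / 2 * f x + (1 - 1 / 2) * g x) ^ 2) + G x := by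
    intro x
    have := hgap0 x
    rw [hG, mul_left_comm, mul_left_comm _ (w x), ← mul_add, ← mul_add,
      ← ENNReal.ofReal_mul (by norm_num), ← ENNReal.ofReal_mul (by norm_num),
      ← ENNReal.ofReal_add (by positivity) (mul_nonneg (by norm_num) (by positivity)),
      ← ENNReal.ofReal_add (by positivity) (by positivity)]
    congr 2
    rw [show 1 / 2 * f x + (1 - 1 / 2) * g x = (f x + g x) / 2 by ring]
    ring
  have hGm : Measurable G := by fun_prop
  rw [← lintegral_const_mul _ (by fun_prop), ← lintegral_const_mul _ (by fun_prop),
    ← lintegral_add_left (by fun_prop), lintegral_congr hpt, lintegral_add_left (by fun_prop)]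
    at h
  have h1 := ENNReal.le_of_add_le_add_left hfin h
  rw [← lintegral_add_left (by fun_prop), ← lintegral_const_mul _ (by fun_prop)]
  calc ∫⁻ x, w x * ENNReal.ofReal √|f x - g x| ∂ν
      ≤ ∫⁻ x, (ENNReal.ofReal (2 / τ ^ 3) * G x + ENNReal.ofReal τ *
          (w x * ENNReal.ofReal √(1 + f x ^ 2) + w x * ENNReal.ofReal √(1 + g x ^ 2))) ∂ν := by
        refine lintegral_mono fun x => ?_
        have := hgap0 x
        rw [hG, ← mul_add, mul_left_comm, mul_left_comm _ (w x), ← mul_add,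
          ← ENNReal.ofReal_add (by positivity) (by positivity),
          ← ENNReal.ofReal_mul (by positivity), ← ENNReal.ofReal_mul (by positivity),
          ← ENNReal.ofReal_add (by positivity) (by positivity)]
        gcongr
        refine (sqrt_abs_sub_le (f x) (g x) hτ).trans_eq ?_
        ring
    _ ≤ _ := by
        rw [lintegral_add_left (by fun_prop), lintegral_const_mul _ hGm]
        gcongr

/-- If the midpoint gaps of `∫ w √(1 + f²)` between successive functions decay like `256⁻ᵏ`, then
the sequence is Cauchy almost everywhere where `w` does not vanish. -/
theorem ae_cauchySeq_of_lintegral_sqrt_gap {α : Type*} [MeasurableSpace α] {ν : Measure α}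
    {f : ℕ → α → ℝ} {w : α → ℝ≥0∞} (hw : Measurable w) (hf : ∀ k, Measurable (f k))
    {M : ℝ≥0∞} (hM : M ≠ ∞) (hfM : ∀ k, ∫⁻ x, w x * ENNReal.ofReal √(1 + f k x ^ 2) ∂ν ≤ M)
    (hfin : ∀ k, ∫⁻ x, w x *
      ENNReal.ofReal √(1 + (1 / 2 * f k x + (1 - 1 / 2) * f (k + 1) x) ^ 2) ∂ν ≠ ∞)
    (hgap : ∀ k, ENNReal.ofReal (1 / 2) * ∫⁻ x, w x * ENNReal.ofReal √(1 + f k x ^ 2) ∂ν +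
      ENNReal.ofReal (1 - 1 / 2) * ∫⁻ x, w x * ENNReal.ofReal √(1 + f (k + 1) x ^ 2) ∂ν ≤
      ∫⁻ x, w x * ENNReal.ofReal √(1 + (1 / 2 * f k x + (1 - 1 / 2) * f (k + 1) x) ^ 2) ∂ν +
        ENNReal.ofReal (1 / 4 * (1 / 256) ^ k)) :
    ∀ᵐ x ∂ν, w x ≠ 0 → CauchySeq fun k => f k x := by
  have hint : ∀ k, ∫⁻ x, ENNReal.ofReal (2 ^ k) *
      (w x * ENNReal.ofReal √|f k x - f (k + 1) x|) ∂ν ≤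
      ENNReal.ofReal ((1 / 2) ^ k) * (1 + (M + M)) := by
    intro k
    -- with `τ = 4⁻ᵏ`, both `τ⁻³ 256⁻ᵏ` and `τ` are `4⁻ᵏ`, which leaves room for the factor `2ᵏ`
    have h1 := lintegral_sqrt_sub_le hw (hf k) (hf (k + 1)) (hfin k) (hgap k)
      (τ := (1 / 4) ^ k) (by positivity)
    have h2 : ENNReal.ofReal (2 / ((1 / 4) ^ k) ^ 3) * ENNReal.ofReal (1 / 4 * (1 / 256) ^ k) ≤
        ENNReal.ofReal ((1 / 4) ^ k) * 1 := by
      rw [mul_one, ← ENNReal.ofReal_mul (by positivity)]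
      refine ENNReal.ofReal_le_ofReal ?_
      have e1 : (1 / 256 : ℝ) ^ k = ((1 / 4) ^ k) ^ 4 := by
        rw [← pow_mul, mul_comm, pow_mul]; norm_num
      have e2 : (0 : ℝ) < (1 / 4) ^ k := by positivity
      rw [e1]
      generalize ((1 : ℝ) / 4) ^ k = τ at *
      rw [div_mul_eq_mul_div, div_le_iff₀ (by positivity)]
      nlinarith [pow_pos e2 4]
    have hdiff : Measurable fun x => w x * ENNReal.ofReal √|f k x - f (k + 1) x| := by
      have h3 : Measurable fun x => |f k x - f (k + 1) x| := ((hf k).sub (hf (k + 1))).abs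
      fun_prop
    rw [lintegral_const_mul _ hdiff]
    calc ENNReal.ofReal (2 ^ k) * ∫⁻ x, w x * ENNReal.ofReal √|f k x - f (k + 1) x| ∂ν
        ≤ ENNReal.ofReal (2 ^ k) * (ENNReal.ofReal ((1 / 4) ^ k) * 1 +
            ENNReal.ofReal ((1 / 4) ^ k) * (M + M)) := by
          gcongr
          refine h1.trans ?_
          gcongr
          · exact hfM k
          · exact hfM (k + 1)
      _ = ENNReal.ofReal ((1 / 2) ^ k) * (1 + (M + M)) := by
          rw [← mul_add, ← mul_assoc, ← ENNReal.ofReal_mul (by positivity), ← mul_pow]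
          norm_num
  have hsum : ∑' k, ∫⁻ x, ENNReal.ofReal (2 ^ k) *
      (w x * ENNReal.ofReal √|f k x - f (k + 1) x|) ∂ν ≠ ∞ := by
    refine ne_top_of_le_ne_top ?_ (ENNReal.tsum_le_tsum hint)
    rw [ENNReal.tsum_mul_right,
      ← ENNReal.ofReal_tsum_of_nonneg (fun _ => by positivity) summable_geometric_two]
    exact ENNReal.mul_ne_top ENNReal.ofReal_ne_top (by simp [hM])
  filter_upwards [tendsto_zero_ae_of_tsum_lintegral_ne_top (fun k => by
    have h3 : Measurable fun x => |f k x - f (k + 1) x| := ((hf k).sub (hf (k + 1))).abs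
    fun_prop) hsum] with x hx hwx
  refine cauchySeq_of_eventually_abs_sub_le (C := 1) (r := 1 / 2) (by norm_num) ?_
  filter_upwards [hx.eventually_lt_const (pos_iff_ne_zero.2 hwx)] with k hk
  have h1 : 2 ^ k * √|f k x - f (k + 1) x| < 1 := by
    by_contra! hcon
    refine absurd hk (not_lt.2 ?_)
    rw [mul_left_comm, ← ENNReal.ofReal_mul (by positivity)]
    exact le_mul_of_one_le_right' (ENNReal.one_le_ofReal.2 hcon)
  have h2 : √|f k x - f (k + 1) x| ≤ (1 / 2) ^ k := by
    rw [one_div, inv_pow, ← one_div, le_div_iff₀ (by positivity), mul_comm]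
    exact h1.le
  rw [abs_sub_comm, one_mul, ← Real.sq_sqrt (abs_nonneg (f k x - f (k + 1) x)), sq]
  exact (mul_le_of_le_one_right (Real.sqrt_nonneg _)
    (h2.trans (pow_le_one₀ (by norm_num) (by norm_num)))).trans h2

/-- If a sum of convex functionals has a small convexity gap, then so has each of them. Here `A`,
`B` and `M` are their values at two points and at a convex combination of these. -/
theorem convex_gap_le {ι : Type*} [Fintype ι] {a d ε : ℝ} (ha : 0 ≤ a) (ha1 : a ≤ 1)
    {A B M : ι → ℝ≥0∞} (hA : ∀ i, A i ≠ ∞) (hB : ∀ i, B i ≠ ∞)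
    (hconv : ∀ i, M i ≤ ENNReal.ofReal a * A i + ENNReal.ofReal (1 - a) * B i)
    (hAd : ∑ i, (A i).toReal ≤ d + ε) (hBd : ∑ i, (B i).toReal ≤ d + ε)
    (hMd : d ≤ ∑ i, (M i).toReal + ε) (i : ι) :
    ENNReal.ofReal a * A i + ENNReal.ofReal (1 - a) * B i ≤ M i + ENNReal.ofReal (2 * ε) := by
  have ha1' : 0 ≤ 1 - a := sub_nonneg.2 ha1
  have hAB : ∀ i, ENNReal.ofReal a * A i + ENNReal.ofReal (1 - a) * B i =
      ENNReal.ofReal (a * (A i).toReal + (1 - a) * (B i).toReal) := fun i => by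
    rw [ENNReal.ofReal_add (by positivity) (by positivity), ENNReal.ofReal_mul ha,
      ENNReal.ofReal_mul ha1', ENNReal.ofReal_toReal (hA i), ENNReal.ofReal_toReal (hB i)]
  have hM : ∀ i, M i ≠ ∞ := fun i =>
    ne_top_of_le_ne_top (by rw [hAB]; exact ENNReal.ofReal_ne_top) (hconv i)
  have hgap : ∀ i, 0 ≤ a * (A i).toReal + (1 - a) * (B i).toReal - (M i).toReal := fun i => by
    have h := hconv i
    rw [hAB] at h
    rw [sub_nonneg]
    exact ENNReal.toReal_le_of_le_ofReal (by positivity) h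
  have hsum := Finset.single_le_sum (fun j _ => hgap j) (Finset.mem_univ i)
  rw [Finset.sum_sub_distrib, Finset.sum_add_distrib, ← Finset.mul_sum, ← Finset.mul_sum] at hsum
  have h1 := mul_le_mul_of_nonneg_left hAd ha
  have h2 := mul_le_mul_of_nonneg_left hBd ha1'
  have hε : a * (A i).toReal + (1 - a) * (B i).toReal ≤ (M i).toReal + 2 * ε := by linarith
  rw [hAB]
  refine (ENNReal.ofReal_le_ofReal hε).trans (ENNReal.ofReal_add_le.trans_eq ?_)
  rw [ENNReal.ofReal_toReal (hM i)]

theorem sqrt_one_add_sq_convex {a : ℝ} (ha : 0 ≤ a) (ha1 : a ≤ 1) (s t : ℝ) :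
    √(1 + (a * s + (1 - a) * t) ^ 2) ≤ a * √(1 + s ^ 2) + (1 - a) * √(1 + t ^ 2) := by
  have hb := sub_nonneg.2 ha1
  rw [Real.sqrt_le_left (by positivity)]
  have hA := Real.sq_sqrt (by positivity : 0 ≤ 1 + s ^ 2)
  have hB := Real.sq_sqrt (by positivity : 0 ≤ 1 + t ^ 2)
  have hAB : 1 + s * t ≤ √(1 + s ^ 2) * √(1 + t ^ 2) := by
    refine le_of_abs_le (abs_le_of_sq_le_sq ?_ (by positivity))
    rw [mul_pow, hA, hB]
    nlinarith [sq_nonneg (s - t)]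
  have e : (a * √(1 + s ^ 2) + (1 - a) * √(1 + t ^ 2)) ^ 2 = a ^ 2 * (1 + s ^ 2) +
      (1 - a) ^ 2 * (1 + t ^ 2) + 2 * (a * (1 - a) * (√(1 + s ^ 2) * √(1 + t ^ 2))) := by
    linear_combination a ^ 2 * hA + (1 - a) ^ 2 * hB
  rw [e]
  linarith [mul_le_mul_of_nonneg_left hAB (mul_nonneg ha hb)]

theorem lintegral_convex_comb_le {α : Type*} [MeasurableSpace α] {ν : Measure α}
    {f g m : α → ℝ≥0∞} (hf : Measurable f) (hg : Measurable g) {a b : ℝ≥0∞}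
    (h : ∀ᵐ x ∂ν, m x ≤ a * f x + b * g x) :
    ∫⁻ x, m x ∂ν ≤ a * ∫⁻ x, f x ∂ν + b * ∫⁻ x, g x ∂ν := by
  rw [← lintegral_const_mul _ hf, ← lintegral_const_mul _ hg,
    ← lintegral_add_left (hf.const_mul a)]
  exact lintegral_mono_ae h

section Space

variable {Φ : X → X → ℝ → ℝ≥0∞} {hΦ : KernelCondition Φ} {μ : Measure X} [SigmaFinite μ]
  {Ω : Set X}

theorem toL0_convex_comb_ae (a : ℝ) (u v : SobolevSpace hΦ μ Ω) :
    toL0 (a • u + (1 - a) • v) =ᵐ[μ] fun x => a * toL0 u x + (1 - a) * toL0 v x := by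
  rw [map_add, map_smul, map_smul]
  filter_upwards [AEEqFun.coeFn_add (a • toL0 u) ((1 - a) • toL0 v),
    AEEqFun.coeFn_smul a (toL0 u), AEEqFun.coeFn_smul (1 - a) (toL0 v)] with x h1 h2 h3
  simp [h1, h2, h3]

theorem toL0_convex_comb_sub_ae (a : ℝ) (u v : SobolevSpace hΦ μ Ω) :
    ∀ᵐ p ∂μ.prod μ, toL0 (a • u + (1 - a) • v) p.1 - toL0 (a • u + (1 - a) • v) p.2 =
      a * (toL0 u p.1 - toL0 u p.2) + (1 - a) * (toL0 v p.1 - toL0 v p.2) := by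
  filter_upwards [ae_prod_of_ae (toL0_convex_comb_ae a u v)] with p hp
  rw [hp.1, hp.2]
  ring

/-! ### Convergence of near minimizers and reflexivity -/

/-- The three parts of the convex functional whose near minimizers converge: the square of the
`L²(Ω)` norm, the energy, and the weighted integral of `√(1 + (u x - u y)²)`. -/
noncomputable def convexParts (w : X × X → ℝ≥0∞) : Fin 3 → SobolevSpace hΦ μ Ω → ℝ≥0∞ :=
  ![fun u => ∫⁻ x in Ω, ENNReal.ofReal (toL0 u x ^ 2) ∂μ,
    fun u => ∫⁻ p, Φ p.1 p.2 (toL0 u p.1 - toL0 u p.2) ∂μ.prod μ,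
    fun u => ∫⁻ p, w p * ENNReal.ofReal √(1 + (toL0 u p.1 - toL0 u p.2) ^ 2) ∂μ.prod μ]

theorem measurable_toL0_sub (u : SobolevSpace hΦ μ Ω) :
    Measurable fun p : X × X => toL0 u p.1 - toL0 u p.2 := by
  have := (toL0 u).measurable
  fun_prop

theorem convexParts_convex_comb_le {w : X × X → ℝ≥0∞} (hw : Measurable w) {a : ℝ} (ha : 0 ≤ a)
    (ha1 : a ≤ 1) (u v : SobolevSpace hΦ μ Ω) (i : Fin 3) :
    convexParts w i (a • u + (1 - a) • v) ≤
      ENNReal.ofReal a * convexParts w i u + ENNReal.ofReal (1 - a) * convexParts w i v := by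
  have hb := sub_nonneg.2 ha1
  have hu := (toL0 u).measurable
  have hv := (toL0 v).measurable
  have hu' := measurable_toL0_sub u
  have hv' := measurable_toL0_sub v
  fin_cases i
  · refine lintegral_convex_comb_le (by fun_prop) (by fun_prop) ?_
    filter_upwards [ae_restrict_of_ae (toL0_convex_comb_ae a u v)] with x hx
    rw [hx, ← ENNReal.ofReal_mul ha, ← ENNReal.ofReal_mul hb,
      ← ENNReal.ofReal_add (by positivity) (by positivity)]
    refine ENNReal.ofReal_le_ofReal ?_
    nlinarith [mul_nonneg (mul_nonneg ha hb) (sq_nonneg (toL0 u x - toL0 v x))]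
  · refine lintegral_convex_comb_le (hΦ.measurable_comp hu') (hΦ.measurable_comp hv') ?_
    filter_upwards [toL0_convex_comb_sub_ae a u v] with p hp
    rw [hp]
    exact hΦ.convex_comb _ _ ha ha1 _ _
  · refine lintegral_convex_comb_le (by fun_prop) (by fun_prop) ?_
    filter_upwards [toL0_convex_comb_sub_ae a u v] with p hp
    rw [hp, mul_left_comm, mul_left_comm (ENNReal.ofReal (1 - a)), ← mul_add,
      ← ENNReal.ofReal_mul ha, ← ENNReal.ofReal_mul hb,
      ← ENNReal.ofReal_add (by positivity) (by positivity)]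
    gcongr
    exact sqrt_one_add_sq_convex ha ha1 _ _

/-- The parts of the functional are bounded on bounded sets. -/
theorem exists_convexParts_le (hΔ : DeltaTwo μ Φ) {w g : X × X → ℝ≥0∞} (hw : Measurable w)
    (hg : Measurable g) (hwi : ∫⁻ p, w p ∂μ.prod μ ≠ ∞) (hgi : ∫⁻ p, g p ∂μ.prod μ ≠ ∞)
    (hwg : ∀ p s, w p * ENNReal.ofReal |s| ≤ Φ p.1 p.2 s + g p) (R : ℝ) :
    ∃ M : ℝ≥0∞, M ≠ ∞ ∧ ∀ u : SobolevSpace hΦ μ Ω, ‖u‖ ≤ R → ∀ i, convexParts w i u ≤ M := by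
  rcases lt_or_ge R 0 with hR | hR
  · exact ⟨0, by simp, fun u hu => absurd (norm_nonneg u) (by linarith)⟩
  obtain ⟨K, H, hK, hHm, hHi, -, hH⟩ := hΔ.exists_le_mul_add hΦ (R + 1)
  have hE : ∀ u : SobolevSpace hΦ μ Ω, ‖u‖ ≤ R →
      ∫⁻ p, Φ p.1 p.2 (toL0 u p.1 - toL0 u p.2) ∂μ.prod μ ≤ K + ∫⁻ p, H p ∂μ.prod μ := by
    intro u hu
    have h1 := energy_toL0_le_one u (r := R + 1) (by linarith)
    rw [hΦ.energy_eq_prod μ (toL0 u).measurable] at h1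
    calc ∫⁻ p, Φ p.1 p.2 (toL0 u p.1 - toL0 u p.2) ∂μ.prod μ
        ≤ ∫⁻ p, (K * Φ p.1 p.2 ((toL0 u p.1 - toL0 u p.2) / (R + 1)) + H p) ∂μ.prod μ := by
          refine lintegral_mono fun p => ?_
          have h2 := hH p ((toL0 u p.1 - toL0 u p.2) / (R + 1))
          rwa [mul_div_cancel₀ _ (by positivity : R + 1 ≠ 0)] at h2
      _ ≤ K + ∫⁻ p, H p ∂μ.prod μ := by
          rw [lintegral_add_right' _ hHm, lintegral_const_mul' _ _ hK]
          gcongr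
          exact mul_le_of_le_one_right' h1
  set M := K + ∫⁻ p, H p ∂μ.prod μ with hM
  have hMt : M ≠ ∞ := ENNReal.add_ne_top.2 ⟨hK, hHi⟩
  refine ⟨ENNReal.ofReal R ^ 2 + M + (∫⁻ p, w p ∂μ.prod μ + (M + ∫⁻ p, g p ∂μ.prod μ)), ?_,
    fun u hu i => ?_⟩
  · simp [hMt, hwi, hgi]
  fin_cases i
  · refine le_add_of_le_left (le_add_of_le_left ?_)
    refine (lintegral_ofReal_sq _).trans_le ?_
    gcongr
    exact (eLpNorm_toL0_le u).trans (ENNReal.ofReal_le_ofReal hu)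
  · exact le_add_of_le_left (le_add_of_le_right (hE u hu))
  · refine le_add_of_le_right ?_
    calc ∫⁻ p, w p * ENNReal.ofReal √(1 + (toL0 u p.1 - toL0 u p.2) ^ 2) ∂μ.prod μ
        ≤ ∫⁻ p, (w p + (Φ p.1 p.2 (toL0 u p.1 - toL0 u p.2) + g p)) ∂μ.prod μ := by
          refine lintegral_mono fun p => ?_
          calc w p * ENNReal.ofReal √(1 + (toL0 u p.1 - toL0 u p.2) ^ 2)
              ≤ w p * ENNReal.ofReal (1 + |toL0 u p.1 - toL0 u p.2|) := by
                gcongr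
                exact sqrt_one_add_sq_le _
            _ = w p + w p * ENNReal.ofReal |toL0 u p.1 - toL0 u p.2| := by
                rw [ENNReal.ofReal_add zero_le_one (abs_nonneg _), mul_add, ENNReal.ofReal_one,
                  mul_one]
            _ ≤ _ := by gcongr; exact hwg _ _
      _ ≤ _ := by
          rw [lintegral_add_left hw, lintegral_add_right _ hg]
          gcongr
          exact hE u hu

/-- A bounded sequence along which the convexity gaps of all three parts decay converges in norm. -/
theorem exists_tendsto_of_convexParts_gap (hΩ : MeasurableSet Ω)
    (hthick : Thick μ Ω (activeSet Φ)) (hΔ : DeltaTwo μ Φ) (hΔ' : DeltaTwo μ (fenchelConj Φ))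
    {w : X × X → ℝ≥0∞} (hw : Measurable w) (hwS : ∀ p ∈ activeSet Φ, w p ≠ 0)
    {u : ℕ → SobolevSpace hΦ μ Ω} {R : ℝ} (hR : ∀ k, ‖u k‖ ≤ R)
    {M : ℝ≥0∞} (hM : M ≠ ∞) (huM : ∀ k i, convexParts w i (u k) ≤ M)
    (hfin : ∀ (v : SobolevSpace hΦ μ Ω) i, convexParts w i v ≠ ∞)
    (hgap : ∀ k m, k ≤ m → ∀ a : ℝ, 0 ≤ a → a ≤ 1 → ∀ i,
      ENNReal.ofReal a * convexParts w i (u k) + ENNReal.ofReal (1 - a) * convexParts w i (u m) ≤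
        convexParts w i (a • u k + (1 - a) • u m) + ENNReal.ofReal (1 / 4 * (1 / 256) ^ k)) :
    ∃ v, Tendsto u atTop (𝓝 v) := by
  have hm := fun k => (toL0 (u k)).measurable
  have hm' := fun k => measurable_toL0_sub (u k)
  have hmixsq : ∀ k m, convexParts w 0 ((1 / 2 : ℝ) • u k + (1 - 1 / 2 : ℝ) • u m) =
      ∫⁻ x in Ω, ENNReal.ofReal ((1 / 2 * toL0 (u k) x + (1 - 1 / 2) * toL0 (u m) x) ^ 2) ∂μ := by
    intro k m
    refine lintegral_congr_ae ?_
    filter_upwards [ae_restrict_of_ae (toL0_convex_comb_ae (1 / 2) (u k) (u m))] with x hx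
    rw [hx]
  have hmixen : ∀ a k m, convexParts w 1 (a • u k + (1 - a) • u m) =
      ∫⁻ p, Φ p.1 p.2 (a * (toL0 (u k) p.1 - toL0 (u k) p.2) +
        (1 - a) * (toL0 (u m) p.1 - toL0 (u m) p.2)) ∂μ.prod μ := by
    intro a k m
    refine lintegral_congr_ae ?_
    filter_upwards [toL0_convex_comb_sub_ae a (u k) (u m)] with p hp
    rw [hp]
  have hmixsqrt : ∀ k m, convexParts w 2 ((1 / 2 : ℝ) • u k + (1 - 1 / 2 : ℝ) • u m) =
      ∫⁻ p, w p * ENNReal.ofReal √(1 + (1 / 2 * (toL0 (u k) p.1 - toL0 (u k) p.2) +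
        (1 - 1 / 2) * (toL0 (u m) p.1 - toL0 (u m) p.2)) ^ 2) ∂μ.prod μ := by
    intro k m
    refine lintegral_congr_ae ?_
    filter_upwards [toL0_convex_comb_sub_ae (1 / 2) (u k) (u m)] with p hp
    rw [hp]
  -- convergence in `L²(Ω)`
  have hL2 : ∀ k m, k ≤ m →
      eLpNorm (fun x => toL0 (u k) x - toL0 (u m) x) 2 (μ.restrict Ω) ≤
        ENNReal.ofReal ((1 / 4) ^ k) := by
    intro k m hkm
    have h := hgap k m hkm (1 / 2) (by norm_num) (by norm_num) 0
    have hf := hfin ((1 / 2 : ℝ) • u k + (1 - 1 / 2 : ℝ) • u m) 0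
    rw [hmixsq] at h hf
    have h1 := lintegral_sq_sub_le (hm k) (hm m) hf h
    rw [lintegral_ofReal_sq, ← ENNReal.ofReal_ofNat 4, ← ENNReal.ofReal_mul (by norm_num)] at h1
    rw [← ENNReal.pow_le_pow_left_iff two_ne_zero]
    refine h1.trans ?_
    rw [← ENNReal.ofReal_pow (by positivity), ← pow_mul, mul_comm k, pow_mul]
    refine ENNReal.ofReal_le_ofReal ?_
    calc (4 : ℝ) * (1 / 4 * (1 / 256) ^ k) = (1 / 256) ^ k := by ring
      _ ≤ ((1 / 4) ^ 2) ^ k := pow_le_pow_left₀ (by norm_num) (by norm_num) k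
  obtain ⟨v, hv⟩ := exists_toL0_tendsto_ae hΩ hthick u (R := R + 1)
    (fun k => (hR k).trans_lt (lt_add_one R))
    (by
      filter_upwards [ae_abs_le_of_eLpNorm_two_le (fun k => (hm k).sub (hm (k + 1)))
        (fun k => hL2 k (k + 1) (Nat.le_succ k))] with x hx
      refine cauchySeq_of_eventually_abs_sub_le (C := 1) (r := 1 / 2) (by norm_num) ?_
      filter_upwards [hx] with k hk
      rw [abs_sub_comm, one_mul]
      exact hk)
    (by
      filter_upwards [ae_cauchySeq_of_lintegral_sqrt_gap hw hm' hM (fun k => huM k 2)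
        (fun k => by rw [← hmixsqrt]; exact hfin _ 2)
        (fun k => by
          rw [← hmixsqrt]
          exact hgap k (k + 1) (Nat.le_succ k) (1 / 2) (by norm_num) (by norm_num) 2)]
        with p hp hpS using hp (hwS p hpS))
  refine ⟨v, ?_⟩
  obtain ⟨a, H, ha0, ha1, hHm, hHi, hH⟩ := hΦ.exists_le_mul_add_of_deltaTwo_fenchelConj hΔ hΔ'
  have hδ : Tendsto (fun k : ℕ => ENNReal.ofReal (1 / 4 * (1 / 256) ^ k)) atTop (𝓝 0) := by
    rw [← ENNReal.ofReal_zero]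
    refine ENNReal.tendsto_ofReal ?_
    rw [← mul_zero (1 / 4 : ℝ)]
    exact (tendsto_pow_atTop_nhds_zero_of_lt_one (r := (1 / 256 : ℝ)) (by norm_num)
      (by norm_num)).const_mul (1 / 4)
  have hen : ∀ r, Tendsto (fun k => energy Φ μ (toL0 (u k - v)) r) atTop (𝓝 0) := by
    intro r
    have h := hΦ.tendsto_lintegral_of_gap hΔ ha0 ha1 hHm hHi hH hm' (measurable_toL0_sub v)
      (by
        filter_upwards [ae_prod_of_ae hv] with p hp using hp.1.sub hp.2)
      (fun k => hfin (u k) 1) (hfin v 1) hδ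
      (fun k m hkm => by
        rw [← hmixen]
        exact hgap k m hkm a ha0.le ha1.le 1) r
    refine h.congr fun k => ?_
    rw [energy_congr Φ μ (toL0_sub_ae (u k) v),
      hΦ.energy_eq_prod μ (u := fun x => toL0 (u k) x - toL0 v x)
        ((hm k).sub (toL0 v).measurable)]
    refine lintegral_congr fun p => ?_
    congr 2
    ring
  have hL2v : ∀ k, eLpNorm (toL0 (u k - v)) 2 (μ.restrict Ω) ≤ ENNReal.ofReal ((1 / 4) ^ k) := by
    intro k
    rw [eLpNorm_congr_ae (ae_restrict_of_ae (toL0_sub_ae (u k) v))]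
    refine (Lp.eLpNorm_lim_le_liminf_eLpNorm
      (f := fun m x => toL0 (u k) x - toL0 (u m) x)
      (fun m => ((hm k).sub (hm m)).aestronglyMeasurable) _ ?_).trans ?_
    · filter_upwards [ae_restrict_of_ae hv] with x hx using tendsto_const_nhds.sub hx
    · exact liminf_le_of_le (by isBoundedDefault) fun b hb =>
        let ⟨m, hm, hkm⟩ := (hb.and (eventually_ge_atTop k)).exists
        hm.trans (hL2 k m hkm)
  rw [tendsto_iff_norm_sub_tendsto_zero, Metric.tendsto_nhds]
  intro ε hε
  have h4 := (tendsto_pow_atTop_nhds_zero_of_lt_one (r := (1 / 4 : ℝ)) (by norm_num)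
    (by norm_num)).eventually_lt_const (show 0 < ε / 4 by positivity)
  filter_upwards [(hen (ε / 4)).eventually_lt_const zero_lt_one, h4] with k hk1 hk2
  rw [dist_zero_right, norm_norm]
  have h5 := norm_le_of_le (u k - v) (r := ε / 4) (by positivity)
    ((hL2v k).trans (ENNReal.ofReal_le_ofReal hk2.le)) hk1.le
  linarith

theorem surjective_inclusionInDoubleDual (hΩ : MeasurableSet Ω)
    (hthick : Thick μ Ω (activeSet Φ)) (hΔ : DeltaTwo μ Φ) (hΔ' : DeltaTwo μ (fenchelConj Φ)) :
    Function.Surjective (NormedSpace.inclusionInDoubleDual ℝ (SobolevSpace hΦ μ Ω)) := by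
  obtain ⟨w, g, hw, hg, hwi, hgi, hwS, hwg⟩ := hΦ.exists_weight μ
  have hbdd := exists_convexParts_le (hΦ := hΦ) (Ω := Ω) hΔ hw hg hwi hgi hwg
  have hfin : ∀ (v : SobolevSpace hΦ μ Ω) i, convexParts w i v ≠ ∞ := fun v i =>
    let ⟨M, hM, hvM⟩ := hbdd ‖v‖
    ne_top_of_le_ne_top hM (hvM v le_rfl i)
  refine surjective_inclusionInDoubleDual_of_near_minimizers
    (fun u => ∑ i, (convexParts w i u).toReal)
    (fun u => Finset.sum_nonneg fun i _ => ENNReal.toReal_nonneg) (fun R => ?_)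
    (fun k => 1 / 8 * (1 / 256) ^ k) (fun k => by positivity) ?_
  · obtain ⟨M, hM, huM⟩ := hbdd R
    exact ⟨∑ _i : Fin 3, M.toReal, fun u hu =>
      Finset.sum_le_sum fun i _ => ENNReal.toReal_mono hM (huM u hu i)⟩
  · intro C d R hC hconv hCR hCd u huC hud
    obtain ⟨M, hM, huM⟩ := hbdd R
    refine exists_tendsto_of_convexParts_gap hΩ hthick hΔ hΔ' hw hwS (fun k => hCR k _ (huC k)) hM
      (fun k => huM _ (hCR k _ (huC k))) hfin fun k m hkm a ha ha1 i => ?_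
    have hε : (1 / 8 : ℝ) * (1 / 256) ^ m ≤ 1 / 8 * (1 / 256) ^ k :=
      mul_le_mul_of_nonneg_left (pow_le_pow_of_le_one (by norm_num) (by norm_num) hkm)
        (by norm_num)
    have h := convex_gap_le ha ha1 (hfin (u k)) (hfin (u m))
      (convexParts_convex_comb_le hw ha ha1 (u k) (u m)) (hud k)
      ((hud m).trans (by gcongr)) (hCd k _ (hconv k (huC k) (hC hkm (huC m)) ha
        (sub_nonneg.2 ha1) (by ring))) i
    convert h using 3
    ring

end Space

end MusielakOrlicz

theorem lemma3p1 {X : Type*} [MeasurableSpace X] (μ : Measure X) [SigmaFinite μ]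
    (Ω : Set X) (hΩ : MeasurableSet Ω)
    (Φ : X → X → ℝ → ℝ≥0∞) (hΦ : MusielakOrlicz.KernelCondition Φ)
    (hΔ : MusielakOrlicz.DeltaTwo μ Φ)
    (hthick : MusielakOrlicz.Thick μ Ω (MusielakOrlicz.activeSet Φ)) :
    ((∀ u : MusielakOrlicz.SobolevSpace hΦ μ Ω, ‖u‖ = 0 → u = 0) ∧
      CompleteSpace (MusielakOrlicz.SobolevSpace hΦ μ Ω)) ∧
    (∀ (u : ℕ → MusielakOrlicz.SobolevSpace hΦ μ Ω) (v : MusielakOrlicz.SobolevSpace hΦ μ Ω),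
      Tendsto u atTop (𝓝 v) →
        ∃ φ : ℕ → ℕ, StrictMono φ ∧
          ∀ᵐ x ∂μ, Tendsto (fun k => MusielakOrlicz.toL0 (u (φ k)) x) atTop
            (𝓝 (MusielakOrlicz.toL0 v x))) ∧
    (MusielakOrlicz.DeltaTwo μ (MusielakOrlicz.fenchelConj Φ) →
      Function.Surjective
        (NormedSpace.inclusionInDoubleDual ℝ (MusielakOrlicz.SobolevSpace hΦ μ Ω))) :=
  ⟨⟨MusielakOrlicz.eq_zero_of_norm_eq_zero hΩ hthick,
      MusielakOrlicz.completeSpace_of_thick hΩ hthick⟩,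
    MusielakOrlicz.exists_subseq_tendsto_ae hΩ hthick,
    MusielakOrlicz.surjective_inclusionInDoubleDual hΩ hthick hΔ⟩
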